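/- Call a triple $(R,\lambda,h)$ of $C^\infty$ functions $\mathbb R\to\mathbb R$ admissible if * $R(r)=r$ for $r\le 1$, $R(r)=3$ for $r\ge 5$, $R'>0$ on $(1,5)$, and $-\tfrac12\le R''\le 0$ on $\mathbb R$; * $\lambda\ge 0$, $\lambda$ is supported in $[-1,1]$, and $\int_{-1}^1\lambda(x)\,dx=1$; * $h(r)=1+e^r$ for $r\le -1$, $h(r)=2e^r$ for $r\ge 1$, and $h\ge 1$, $h'>0$, $h''>0$ on $\mathbb R$. For such a triple put $\bar f(s)=1$ for $s\le 0$, $\bar f(s)=e^s$ for $s>0$, and let $f(s)=\int_{\mathbb R}\bar f(t)\lambda(s-t)\,dt$ and $c=\int_{\mathbb R}e^{t}\lambda(-t)\,dt$. Admissible triples exist. Let $(R,\lambda,h)$ be any admissible triple, let $b>0$ be a real number and let $l,m\ge 1$ be integers. Put $F(r,t)=b\,e^{R(r)}f(t-R(r))$. Then, on $Y=\mathbb R\times\mathbb R\times\mathbb R^l\times\mathbb R^m$ with coordinates $(r,t,\rho,\tau)$ and with $d\rho^2,d\tau^2$ the Euclidean metrics of $\mathbb R^l,\mathbb R^m$,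 $$g=dr^2+h(r)^2\bigl(dt^2+b^2e^{2R(r)}d\rho^2+F(r,t)^2d\tau^2\bigr)$$ is a $C^\infty$ Riemannian metric, it is invariant under $\mathrm{Isom}(\mathbb R^l)$ and $\mathrm{Isom}(\mathbb R^m)$ (each acting on its own factor), and the following hold. 1. There is a constant $C<0$ such that every sectional curvature $K$ of $g$ satisfies $C\le K<0$. 2. Let $T^l=\mathbb R^l/\Lambda$ and $T^m=\mathbb R^m/\Lambda'$ be flat tori, where $\Lambda,\Lambda'$ are full-rank lattices acting by translations. Then $g$ descends to a metric on $\mathbb R\times\mathbb R\times T^l\times T^m$, for which the set $\{(r,t,\rho,\tau)\mid r\in(-\infty,-1],\ t\in[r-1,2],\ \rho\in T^l,\ \tau\in T^m\}$ has finite Riemannian volume. 3. For $r\le 0$ and $t\le r-1$, $g=dr^2+h(r)^2(dt^2+b^2e^{2r}d\rho^2+b^2e^{2r}d\tau^2)$. 4. For $r\ge 0$ and $t\le -1$, $g=dr^2+h(r)^2(dt^2+b^2e^{2R(r)}d\rho^2+b^2e^{2R(r)}d\tau^2)$. 5. For $r\in\mathbb R$ and $t\ge 4$, $g=dr^2+h(r)^2(dt^2+b^2e^{2R(r)}d\rho^2+b^2c^2e^{2t}d\tau^2)$.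 6. For $r\ge 5$, $g$ is the warped product metric $g=dr^2+4e^{2r}\hat g$, where $\hat g=dt^2+b^2e^6d\rho^2+b^2e^6f(t-3)^2d\tau^2$ is a $C^\infty$ Riemannian metric on $\mathbb R\times\mathbb R^l\times\mathbb R^m$. 7. All sectional curvatures of $\hat g$ are non-positive. -/

import Mathlib

open MeasureTheory Set
open scoped ContDiff Manifold

noncomputable section

namespace RiemVS

variable {E : Type*} [NormedAddCommGroup E] [NormedSpace ℝ E]

/-- A `C^∞` Riemannian metric on a normed space `E`, regarded as a manifold modelled on itself. -/
abbrev Metric (E : Type*) [NormedAddCommGroup E] [NormedSpace ℝ E] :=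
  Bundle.ContMDiffRiemannianMetric 𝓘(ℝ, E) ∞ E (fun x : E => TangentSpace 𝓘(ℝ, E) x)

/-- The metric tensor as a field of bilinear forms on `E`, through the canonical identification of
each tangent space with `E`. -/
def form (g : Metric E) (x : E) : E →L[ℝ] E →L[ℝ] ℝ := g.inner x

/-- The Christoffel map `Γ_x(u, v) = ∇_u v` (for constant fields `u, v`) of the Levi-Civita
connection, obtained by raising the index in
`G(Γ(u, v), w) = (D_u G(v, w) + D_v G(u, w) - D_w G(u, v)) / 2`. -/
def christoffel (G : E → E →L[ℝ] E →L[ℝ] ℝ) (x u v : E) : E :=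
  (G x).inverse ((1 / 2 : ℝ) •
    (fderiv ℝ (fun z => G z v) x u + fderiv ℝ (fun z => G z u) x v
      - fderiv ℝ (fun z => G z u v) x))

/-- The curvature tensor `R(u, v) w = ∇_u ∇_v w - ∇_v ∇_u w` for constant fields `u, v, w`. -/
def curvature (G : E → E →L[ℝ] E →L[ℝ] ℝ) (x u v w : E) : E :=
  fderiv ℝ (fun z => christoffel G z v w) x u - fderiv ℝ (fun z => christoffel G z u w) x v
    + christoffel G x u (christoffel G x v w) - christoffel G x v (christoffel G x u w)

/-- The sectional curvature at `x` of the plane spanned by the linearly independent vectors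
`u, v`. -/
def sectional (g : Metric E) (x u v : E) : ℝ :=
  form g x (curvature (form g) x u v v) u /
    (form g x u u * form g x v v - form g x u v ^ 2)

/-- `Φ : E → E` is smooth and pulls `g` back to itself. -/
def Preserves (g : Metric E) (Φ : E → E) : Prop :=
  ContDiff ℝ ∞ Φ ∧
    ∀ x u v : E, form g (Φ x) (fderiv ℝ Φ x u) (fderiv ℝ Φ x v) = form g x u v

/-- The Riemannian volume `√(det g_ij) dx₁ ⋯ dx_n` in the linear coordinates of a basis `B`. (As a
measure it does not depend on `B`.) -/
def volumeOf {ι : Type*} [Fintype ι] [DecidableEq ι] [MeasurableSpace E] [BorelSpace E]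
    (B : Module.Basis ι ℝ E) (g : Metric E) : Measure E :=
  B.addHaar.withDensity fun x =>
    ENNReal.ofReal (Real.sqrt (Matrix.det (Matrix.of fun i j => form g x (B i) (B j))))

/-- `μ` is the measure on `X` for which the covering `p : E → X` is locally measure preserving from
`(E, ν)`: if `ν` is a Riemannian volume and `p` is a Riemannian covering, `μ` is the Riemannian
volume of `X`. -/
def IsQuotientVolume {X : Type*} [MeasurableSpace E] [MeasurableSpace X] (p : E → X)
    (ν : Measure E) (μ : Measure X) : Prop :=
  ∀ U : Set E, MeasurableSet U → InjOn p U → μ (p '' U) = ν U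

end RiemVS

namespace WarpedModel

/-- `ℝ × ℝ^l × ℝ^m`, with coordinates `(t, ρ, τ)`. -/
abbrev Z (l m : ℕ) := ℝ × EuclideanSpace ℝ (Fin l) × EuclideanSpace ℝ (Fin m)

/-- `ℝ × ℝ × ℝ^l × ℝ^m`, with coordinates `(r, t, ρ, τ)`. -/
abbrev Y (l m : ℕ) := ℝ × Z l m

/-- The standard basis `∂_r, ∂_t, ∂_{ρ_α}, ∂_{τ_β}` of `Y`. -/
def stdBasis (l m : ℕ) : Module.Basis (Unit ⊕ Unit ⊕ Fin l ⊕ Fin m) ℝ (Y l m) :=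
  (Module.Basis.singleton Unit ℝ).prod ((Module.Basis.singleton Unit ℝ).prod
    ((EuclideanSpace.basisFun (Fin l) ℝ).toBasis.prod (EuclideanSpace.basisFun (Fin m) ℝ).toBasis))

/-- The bilinear form `dt² + P dρ² + Q dτ²` on `ℝ × ℝ^l × ℝ^m`. -/
def formZ {l m : ℕ} (P Q : ℝ) (v w : Z l m) : ℝ :=
  v.1 * w.1 + P * inner ℝ v.2.1 w.2.1 + Q * inner ℝ v.2.2 w.2.2

/-- The bilinear form `dr² + A (dt² + P dρ² + Q dτ²)` on `ℝ × ℝ × ℝ^l × ℝ^m`. -/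
def formY {l m : ℕ} (A P Q : ℝ) (v w : Y l m) : ℝ :=
  v.1 * w.1 + A * formZ P Q v.2 w.2

/-- Auxiliary functions `R`, `h`, `lam` (`λ`) from which the metric is built. -/
structure Profile where
  R : ℝ → ℝ
  h : ℝ → ℝ
  lam : ℝ → ℝ
  R_smooth : ContDiff ℝ ∞ R
  R_left : ∀ r ≤ 1, R r = r
  R_right : ∀ r, 5 ≤ r → R r = 3
  R_deriv_pos : ∀ r ∈ Ioo (1 : ℝ) 5, 0 < deriv R r
  R_deriv2_ge : ∀ r, -(1 / 2) ≤ deriv (deriv R) r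
  R_deriv2_nonpos : ∀ r, deriv (deriv R) r ≤ 0
  lam_smooth : ContDiff ℝ ∞ lam
  lam_nonneg : ∀ x, 0 ≤ lam x
  lam_support : Function.support lam ⊆ Icc (-1) 1
  lam_integral : ∫ x in (-1 : ℝ)..1, lam x = 1
  h_smooth : ContDiff ℝ ∞ h
  h_left : ∀ r ≤ -1, h r = 1 + Real.exp r
  h_right : ∀ r, 1 ≤ r → h r = 2 * Real.exp r
  h_ge_one : ∀ r, 1 ≤ h r
  h_deriv_pos : ∀ r, 0 < deriv h r
  h_deriv2_pos : ∀ r, 0 < deriv (deriv h) r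

/-- `1` for `s ≤ 0` and `e^s` for `s > 0`. -/
def fbar (s : ℝ) : ℝ := if s ≤ 0 then 1 else Real.exp s

/-- The convolution `λ * φ`. -/
def Profile.conv (D : Profile) (φ : ℝ → ℝ) (x : ℝ) : ℝ := ∫ t, φ t * D.lam (x - t)

/-- `f = λ * fbar`. -/
def Profile.f (D : Profile) : ℝ → ℝ := D.conv fbar

/-- `c = (λ * exp)(0)`. -/
def Profile.c (D : Profile) : ℝ := D.conv Real.exp 0

/-- `F(r, t) = b e^{R(r)} f(t - R(r))`. -/
def Profile.F (D : Profile) (b r t : ℝ) : ℝ := b * Real.exp (D.R r) * D.f (t - D.R r)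

/-- `ℝ × ℝ × T^l × T^m` for the flat tori `T^l = ℝ^l / Λ` and `T^m = ℝ^m / Λ'`. -/
abbrev X {l m : ℕ} (L : Submodule ℤ (EuclideanSpace ℝ (Fin l)))
    (L' : Submodule ℤ (EuclideanSpace ℝ (Fin m))) :=
  ℝ × ℝ × (EuclideanSpace ℝ (Fin l) ⧸ L.toAddSubgroup) ×
    (EuclideanSpace ℝ (Fin m) ⧸ L'.toAddSubgroup)

/-- The covering projection `Y → ℝ × ℝ × T^l × T^m`. -/
def proj {l m : ℕ} (L : Submodule ℤ (EuclideanSpace ℝ (Fin l)))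
    (L' : Submodule ℤ (EuclideanSpace ℝ (Fin m))) (y : Y l m) : X L L' :=
  (y.1, y.2.1, QuotientAddGroup.mk y.2.2.1, QuotientAddGroup.mk y.2.2.2)

end WarpedModel

end

/-! The metric has four mutually orthogonal blocks, `dr² + h² dt² + p² dρ² + q² dτ²`, with `p = b
e^R h` and `q = h F`. Only `r` and `t` are active variables, so the whole curvature tensor is an
explicit expression in the first two derivatives of `h`, `p`, `q`. In the adapted orthonormal frame
it is diagonal on bivectors, except for one coupling between the `r∧τ` and `t∧τ` directions, because
`q` depends on both `r` and `t`.

The function `f = λ * fbar` splits as `f = tail + f'`, where `tail` decreases from 1 to 0, `tail' =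
-λ` and `f'' = f' + λ`. Hence `∂_r (e^R f(t - R)) = e^R R' tail`, and in the coupling term
everything cancels except `-R' λ`. Its square is exactly the product of the two contributions of `λ`
to the diagonal entries, so the 2×2 block is positive definite as soon as the rest of its diagonal
is positive. That rest, like the `r∧ρ` coefficient, is positive because `h'' + h R'' > 0`: `R''`
vanishes for `r < 1`, and for `r ≥ 1` one has `h'' = h` and `R'' ≥ -1/2`. See
`curvature_metricForm`, `curvature_coeff_pos`, `deriv2_h_add_pos`.

All coefficients are bounded above, because `h'/h`, `h''/h`, `R'`, `λ` and `f'/f` are bounded and `h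
≥ 1` (`curvature_coeff_le`). This gives the uniform lower bound on `K`; negativity is only
pointwise, since `h''/h → 0` as `r → -∞`.

For the volume, the density on the given end is at most a constant times `e^r`, and `t ≥ r - 1`
bounds this by a constant times `e^{r/2} e^{t/2}`, which is integrable over a product region
(`sqrt_det_le`). The normal forms of `g` follow from `f = 1` on `(-∞, -1]` and `f(s) = c e^s` on
`[1, ∞)`. The curvature of the slice metric is non-positive because `f ≥ 0` and `f'' ≥ 0`. -/

noncomputable section

namespace RiemVS

variable {E : Type*} [NormedAddCommGroup E] [NormedSpace ℝ E]

/-! ### Levi-Civita connection and curvature of a metric on a vector space -/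

section General

variable {G : E → E →L[ℝ] E →L[ℝ] ℝ}

theorem contDiff_fderiv_form (hG : ContDiff ℝ ∞ G) (u v w : E) :
    ContDiff ℝ ∞ (fun z => fderiv ℝ (fun z => G z u v) z w) :=
  (((hG.clm_apply contDiff_const).clm_apply contDiff_const).fderiv_right (m := ∞)
    (by simp)).clm_apply contDiff_const

variable [FiniteDimensional ℝ E]

theorem isInvertible_of_posDef (B : E →L[ℝ] E →L[ℝ] ℝ) (hB : ∀ v, v ≠ 0 → 0 < B v v) :
    B.IsInvertible := by
  have hinj : Function.Injective B := by
    rw [injective_iff_map_eq_zero]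
    intro v hv
    by_contra h
    have := hB v h
    simp [hv] at this
  have hdim : Module.finrank ℝ E = Module.finrank ℝ (E →L[ℝ] ℝ) := by
    rw [← (LinearMap.toContinuousLinearMap (𝕜 := ℝ) (E := E) (F' := ℝ)).finrank_eq]
    exact (Subspace.dual_finrank_eq (K := ℝ) (V := E)).symm
  let e : E ≃ₗ[ℝ] (E →L[ℝ] ℝ) :=
    LinearEquiv.ofInjectiveOfFinrankEq B.toLinearMap hinj hdim
  refine ⟨e.toContinuousLinearEquiv, ?_⟩
  ext v w
  rfl

/-- The Christoffel map is characterised by its lowered form. -/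
theorem form_christoffel (hpos : ∀ x v, v ≠ 0 → 0 < G x v v)
    (hG : ContDiff ℝ ∞ G) (x u v w : E) :
    G x (christoffel G x u v) w = (1 / 2 : ℝ) *
      (fderiv ℝ (fun z => G z v w) x u + fderiv ℝ (fun z => G z u w) x v
        - fderiv ℝ (fun z => G z u v) x w) := by
  have hd : DifferentiableAt ℝ G x := hG.differentiable (by simp) x
  have h1 : ∀ a c : E, fderiv ℝ (fun z => G z a) x c w = fderiv ℝ (fun z => G z a w) x c := by
    intro a c
    rw [fderiv_clm_apply (hd.clm_apply (differentiableAt_const a)) (differentiableAt_const w)]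
    simp
  unfold christoffel
  rw [(isInvertible_of_posDef (G x) (hpos x)).self_apply_inverse]
  simp [h1]

theorem christoffel_eq_of_form (hpos : ∀ x v, v ≠ 0 → 0 < G x v v)
    (hG : ContDiff ℝ ∞ G) {x u v Γ : E}
    (h : ∀ w, G x Γ w = (1 / 2 : ℝ) *
      (fderiv ℝ (fun z => G z v w) x u + fderiv ℝ (fun z => G z u w) x v
        - fderiv ℝ (fun z => G z u v) x w)) :
    christoffel G x u v = Γ := by
  apply (isInvertible_of_posDef (G x) (hpos x)).injective
  ext w
  rw [h, form_christoffel hpos hG]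

theorem differentiable_christoffel (hpos : ∀ x v, v ≠ 0 → 0 < G x v v)
    (hG : ContDiff ℝ ∞ G) (u v : E) : Differentiable ℝ (fun z => christoffel G z u v) := by
  intro x
  have h1 : DifferentiableAt ℝ (fun z => (G z).inverse) x := by
    have h := (isInvertible_of_posDef (G x) (hpos x)).contDiffAt_map_inverse (n := 1)
    exact (h.differentiableAt (by simp)).comp x (hG.differentiable (by simp) x)
  have h2 : ∀ a c : E, Differentiable ℝ (fun z => fderiv ℝ (fun z => G z a) z c) := fun a c =>
    (((hG.clm_apply contDiff_const).fderiv_right (m := ∞) (by simp)).clm_apply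
      contDiff_const).differentiable (by simp)
  have h3 : Differentiable ℝ (fun z => fderiv ℝ (fun z => G z u v) z) :=
    (((hG.clm_apply contDiff_const).clm_apply contDiff_const).fderiv_right
      (m := ∞) (by simp)).differentiable (by simp)
  unfold christoffel
  exact h1.clm_apply (((((h2 v u).add (h2 u v)).sub h3).const_smul (1 / 2 : ℝ)) x)

/-- Metric compatibility of the connection: adding the two lowered Christoffel expressions cancels
all but one derivative. -/
theorem fderiv_form_eq (hpos : ∀ x v, v ≠ 0 → 0 < G x v v) (hsymm : ∀ x v w, G x v w = G x w v)
    (hG : ContDiff ℝ ∞ G) (x u v w : E) :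
    fderiv ℝ (fun z => G z v w) x u =
      G x (christoffel G x u v) w + G x v (christoffel G x u w) := by
  rw [hsymm x v, form_christoffel hpos hG, form_christoffel hpos hG]
  have h : ∀ a c, (fun z => G z a c) = fun z => G z c a := fun a c => funext fun z => hsymm z a c
  rw [h w v, h u w]
  ring

/-- Product rule for `z ↦ G z (christoffel G z u v) w`. It trades the derivative of the Christoffel
map, which contains the inverse of `G`, for the derivative of its lowered form. -/
theorem form_fderiv_christoffel (hpos : ∀ x v, v ≠ 0 → 0 < G x v v)
    (hG : ContDiff ℝ ∞ G) (x a u v w : E) :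
    G x (fderiv ℝ (fun z => christoffel G z u v) x a) w =
      fderiv ℝ (fun z => G z (christoffel G z u v) w) x a
        - fderiv ℝ (fun z => G z (christoffel G x u v) w) x a := by
  have hd : DifferentiableAt ℝ G x := hG.differentiable (by simp) x
  have hc := differentiable_christoffel hpos hG u v x
  rw [fderiv_clm_apply (hd.clm_apply hc) (differentiableAt_const w), fderiv_clm_apply hd hc,
    fderiv_clm_apply (hd.clm_apply (differentiableAt_const _)) (differentiableAt_const w),
    fderiv_clm_apply hd (differentiableAt_const _)]
  simp

/-- The numerator of the sectional curvature in terms of second derivatives of the metric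
coefficients and the Christoffel map. -/
theorem form_curvature (hpos : ∀ x v, v ≠ 0 → 0 < G x v v) (hsymm : ∀ x v w, G x v w = G x w v)
    (hG : ContDiff ℝ ∞ G) (x u v : E) :
    G x (curvature G x u v v) u =
      fderiv ℝ (fun z => fderiv ℝ (fun z => G z u v) z v) x u
        - 1 / 2 * fderiv ℝ (fun z => fderiv ℝ (fun z => G z v v) z u) x u
        - 1 / 2 * fderiv ℝ (fun z => fderiv ℝ (fun z => G z u u) z v) x v
        + G x (christoffel G x u v) (christoffel G x u v)
        - G x (christoffel G x u u) (christoffel G x v v) := by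
  have hs : ∀ a c, (fun z => G z a c) = fun z => G z c a := fun a c => funext fun z => hsymm z a c
  have hd : ∀ a b c, DifferentiableAt ℝ (fun z => fderiv ℝ (fun z => G z a b) z c) x := fun a b c =>
    (contDiff_fderiv_form hG a b c).differentiable (by simp) x
  -- Paired with `u`, the Christoffel maps are combinations of first derivatives of the
  -- coefficients, so the curvature needs only second derivatives of `G` and products of Christoffel
  -- vectors.
  have e1 : (fun z => G z (christoffel G z v v) u) = fun z =>
      fderiv ℝ (fun z => G z u v) z v - 1 / 2 * fderiv ℝ (fun z => G z v v) z u := by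
    funext z
    rw [form_christoffel hpos hG, hs v u]; ring
  have e2 : (fun z => G z (christoffel G z u v) u) = fun z =>
      1 / 2 * fderiv ℝ (fun z => G z u u) z v := by
    funext z
    rw [form_christoffel hpos hG, hs v u]; ring
  unfold curvature
  simp only [map_add, map_sub, add_apply, sub_apply]
  rw [form_fderiv_christoffel hpos hG, form_fderiv_christoffel hpos hG, e1, e2,
    fderiv_fun_sub (hd _ _ _) ((hd _ _ _).const_mul _), fderiv_const_mul (hd _ _ _),
    fderiv_const_mul (hd _ _ _), fderiv_form_eq hpos hsymm hG x u _ u,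
    fderiv_form_eq hpos hsymm hG x v _ u]
  have hc : christoffel G x v u = christoffel G x u v := by
    unfold christoffel
    rw [show (fun z => G z v u) = fun z => G z u v from hs v u, add_comm]
  rw [hc, hsymm x (christoffel G x v v) (christoffel G x u u)]
  simp
  ring

end General

/-- The vector `B v v • u - B u v • v` is a multiple of the part of `u` orthogonal to `v`; its
square length is `B v v` times the Gram determinant. -/
theorem area_pos (B : E →L[ℝ] E →L[ℝ] ℝ) (hB : ∀ v, v ≠ 0 → 0 < B v v)
    (hs : ∀ v w, B v w = B w v) {u v : E} (h : LinearIndependent ℝ ![u, v]) :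
    0 < B u u * B v v - B u v ^ 2 := by
  have hv : v ≠ 0 := h.ne_zero 1
  have hvv := hB v hv
  have hne : B v v • u - B u v • v ≠ 0 := by
    intro h0
    have := LinearIndependent.pair_iff.1 h (B v v) (-B u v) (by rw [neg_smul, ← sub_eq_add_neg, h0])
    exact hvv.ne' this.1
  have := hB _ hne
  simp only [map_sub, map_smul, sub_apply, smul_apply,
    smul_eq_mul, hs v u] at this
  have h2 : 0 < B v v * (B u u * B v v - B u v ^ 2) := by nlinarith
  exact pos_of_mul_pos_right h2 hvv.le

/-- By compactness the form attains a positive minimum on the unit sphere, so it dominates a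
multiple of the squared norm. -/
theorem isVonNBounded_of_posDef [FiniteDimensional ℝ E] (B : E →L[ℝ] E →L[ℝ] ℝ)
    (hB : ∀ v, v ≠ 0 → 0 < B v v) : Bornology.IsVonNBounded ℝ {v : E | B v v < 1} := by
  rcases subsingleton_or_nontrivial E with hE | hE
  · exact (Set.toFinite _).isVonNBounded
  obtain ⟨w, hw, hmin⟩ := (isCompact_sphere (0 : E) 1).exists_isMinOn
    (NormedSpace.sphere_nonempty.2 zero_le_one)
    (f := fun v => B v v) (by fun_prop)
  have hw0 : w ≠ 0 := by
    intro h
    simp [h] at hw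
  have hm := hB w hw0
  refine (NormedSpace.isVonNBounded_ball ℝ E (1 / Real.sqrt (B w w) + 1)).subset ?_
  intro v hv
  simp only [mem_ofPred_eq] at hv
  rw [mem_ball_zero_iff]
  rcases eq_or_ne v 0 with rfl | h0
  · simp; positivity
  have hn : 0 < ‖v‖ := norm_pos_iff.2 h0
  have h1 : B w w ≤ B (‖v‖⁻¹ • v) (‖v‖⁻¹ • v) := hmin (by simp [norm_smul, hn.ne'])
  simp only [map_smul, smul_apply, smul_eq_mul] at h1
  have h2 : B w w * ‖v‖ ^ 2 ≤ B v v := by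
    calc B w w * ‖v‖ ^ 2 ≤ (‖v‖⁻¹ * (‖v‖⁻¹ * B v v)) * ‖v‖ ^ 2 := by gcongr
      _ = B v v := by field_simp
  have h3 : Real.sqrt (B w w) * ‖v‖ < 1 := by
    rw [← Real.sqrt_sq hn.le, ← Real.sqrt_mul hm.le, Real.sqrt_lt' one_pos]
    linarith
  have h4 : ‖v‖ < 1 / Real.sqrt (B w w) := by
    rw [lt_div_iff₀ (Real.sqrt_pos.2 hm)]; linarith
  linarith

/-- A coefficient field as a field of bilinear forms on the tangent spaces. -/
def tangentForm (G : E → E →L[ℝ] E →L[ℝ] ℝ) (x : E) :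
    TangentSpace 𝓘(ℝ, E) x →L[ℝ] TangentSpace 𝓘(ℝ, E) x →L[ℝ] ℝ := G x

/-- The Riemannian metric with a given smooth positive definite coefficient field. -/
def ofForm [FiniteDimensional ℝ E] (G : E → E →L[ℝ] E →L[ℝ] ℝ)
    (hsymm : ∀ x v w, G x v w = G x w v) (hpos : ∀ x v, v ≠ 0 → 0 < G x v v)
    (hG : ContDiff ℝ ∞ G) : Metric E where
  inner x := tangentForm G x
  symm x v w := hsymm x v w
  pos x v hv := hpos x v hv
  isVonNBounded x := isVonNBounded_of_posDef (G x) (hpos x)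
  contMDiff := by
    intro x
    rw [Bundle.contMDiffAt_section]
    convert! hG.contMDiff x
    ext v w
    rw [hom_trivializationAt_apply]
    -- Over the model space the tangent trivialization is global and is the identity, so the section
    -- read in coordinates is `G` itself.
    have hm : ∀ y : E, y ∈ (trivializationAt E (TangentSpace 𝓘(ℝ, E)) x).baseSet := fun y => by
      rw [TangentBundle.trivializationAt_baseSet, chartAt_self_eq]
      exact mem_univ y
    have hs : ∀ y (a : E), (trivializationAt E (TangentSpace 𝓘(ℝ, E)) x).symm y a = a := fun y a => by
      rw [← Bundle.Trivialization.symmL_apply (R := ℝ) _ (hm y)]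
      exact DFunLike.congr_fun (TangentBundle.symmL_model_space (𝕜 := ℝ) x y) a
    rw [inCoordinates_apply_eq₂ (hm _) (hm _) (by simp), hs, hs]
    simp
    rfl

theorem form_ofForm [FiniteDimensional ℝ E] (G : E → E →L[ℝ] E →L[ℝ] ℝ)
    (hsymm : ∀ x v w, G x v w = G x w v) (hpos : ∀ x v, v ≠ 0 → 0 < G x v v)
    (hG : ContDiff ℝ ∞ G) : form (ofForm G hsymm hpos hG) = G := rfl

end RiemVS

/-! ### Curvature of metrics with four orthogonal blocks -/

namespace RiemVS

section Blocks

variable {E F : Type*} [NormedAddCommGroup E] [NormedSpace ℝ E]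
  [NormedAddCommGroup F] [InnerProductSpace ℝ F]

/-- The pullback of the inner product of `F` along `p : E → F`. -/
def pullInner (p : E →L[ℝ] F) : E →L[ℝ] E →L[ℝ] ℝ := (innerSL ℝ (E := F)).bilinearComp p p

@[simp]
theorem pullInner_apply (p : E →L[ℝ] F) (v w : E) : pullInner p v w = inner ℝ (p v) (p w) := rfl

end Blocks

variable {V W : Type*} [NormedAddCommGroup V] [InnerProductSpace ℝ V]
  [NormedAddCommGroup W] [InnerProductSpace ℝ W]

section FourBlocks

set_option maxSynthPendingDepth 5

/-- The metric `dr² + h² dt² + p² dρ² + q² dτ²` on `ℝ × ℝ × V × W`. -/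
def fourBlock (h p : ℝ → ℝ) (q : ℝ → ℝ → ℝ) (y : ℝ × ℝ × V × W) :
    (ℝ × ℝ × V × W) →L[ℝ] (ℝ × ℝ × V × W) →L[ℝ] ℝ :=
  pullInner (.fst ℝ ℝ (ℝ × V × W))
    + h y.1 ^ 2 • pullInner (.fst ℝ ℝ (V × W) ∘L .snd ℝ ℝ (ℝ × V × W))
    + p y.1 ^ 2 • pullInner (.fst ℝ V W ∘L .snd ℝ ℝ (V × W) ∘L .snd ℝ ℝ (ℝ × V × W))
    + q y.1 y.2.1 ^ 2 • pullInner (.snd ℝ V W ∘L .snd ℝ ℝ (V × W) ∘L .snd ℝ ℝ (ℝ × V × W))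

variable {h p : ℝ → ℝ} {q : ℝ → ℝ → ℝ}

theorem fourBlock_apply (y v w : ℝ × ℝ × V × W) :
    fourBlock h p q y v w = v.1 * w.1 + h y.1 ^ 2 * (v.2.1 * w.2.1)
      + p y.1 ^ 2 * inner ℝ v.2.2.1 w.2.2.1 + q y.1 y.2.1 ^ 2 * inner ℝ v.2.2.2 w.2.2.2 := by
  simp [fourBlock, mul_comm]

theorem fourBlock_symm (y v w : ℝ × ℝ × V × W) :
    fourBlock h p q y v w = fourBlock h p q y w v := by
  rw [fourBlock_apply, fourBlock_apply, real_inner_comm, real_inner_comm w.2.2.2]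
  ring

theorem fourBlock_pos (hh : ∀ r, 0 < h r) (hp : ∀ r, 0 < p r) (hq : ∀ r t, 0 < q r t)
    (y v : ℝ × ℝ × V × W) (hv : v ≠ 0) : 0 < fourBlock h p q y v v := by
  rw [fourBlock_apply]
  have h2 := pow_pos (hh y.1) 2
  have h3 := pow_pos (hp y.1) 2
  have h4 := pow_pos (hq y.1 y.2.1) 2
  have i3 := real_inner_self_nonneg (x := v.2.2.1)
  have i4 := real_inner_self_nonneg (x := v.2.2.2)
  have n1 := mul_self_nonneg v.1
  have n2 := mul_nonneg h2.le (mul_self_nonneg v.2.1)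
  have n3 := mul_nonneg h3.le i3
  have n4 := mul_nonneg h4.le i4
  by_contra hle
  have z1 : v.1 = 0 := mul_self_eq_zero.1 (by linarith)
  have z2 : v.2.1 = 0 := mul_self_eq_zero.1
    ((mul_eq_zero_iff_left h2.ne').1 (by linarith : h y.1 ^ 2 * (v.2.1 * v.2.1) = 0))
  have z3 : v.2.2.1 = 0 := inner_self_eq_zero.1
    ((mul_eq_zero_iff_left h3.ne').1 (by linarith : p y.1 ^ 2 * inner ℝ v.2.2.1 v.2.2.1 = 0))
  have z4 : v.2.2.2 = 0 := inner_self_eq_zero.1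
    ((mul_eq_zero_iff_left h4.ne').1
      (by linarith : q y.1 y.2.1 ^ 2 * inner ℝ v.2.2.2 v.2.2.2 = 0))
  exact hv (Prod.ext z1 (Prod.ext z2 (Prod.ext z3 z4)))

theorem contDiff_fourBlock (hh : ContDiff ℝ ∞ h) (hp : ContDiff ℝ ∞ p)
    (hq : ContDiff ℝ ∞ fun x : ℝ × ℝ => q x.1 x.2) :
    ContDiff ℝ ∞ (fourBlock (V := V) (W := W) h p q) := by
  have hq' : ContDiff ℝ ∞ fun y : ℝ × ℝ × V × W => q y.1 y.2.1 :=
    hq.comp (contDiff_fst.prodMk contDiff_snd.fst)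
  unfold fourBlock
  exact ((contDiff_const.add (((hh.comp contDiff_fst).pow 2).smul contDiff_const)).add
    (((hp.comp contDiff_fst).pow 2).smul contDiff_const)).add ((hq'.pow 2).smul contDiff_const)

/-- The 1-form `a dr + b dt` on `ℝ × ℝ × F`. -/
def baseForm {F : Type*} [NormedAddCommGroup F] [NormedSpace ℝ F] (a b : ℝ) :
    (ℝ × ℝ × F) →L[ℝ] ℝ :=
  a • .fst ℝ ℝ (ℝ × F) + b • (.fst ℝ ℝ F ∘L .snd ℝ ℝ (ℝ × F))

@[simp]
theorem baseForm_apply {F : Type*} [NormedAddCommGroup F] [NormedSpace ℝ F] (a b : ℝ)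
    (v : ℝ × ℝ × F) : baseForm a b v = a * v.1 + b * v.2.1 := by
  simp [baseForm]

theorem hasFDerivAt_comp_fst {F : Type*} [NormedAddCommGroup F] [NormedSpace ℝ F] {k k' : ℝ → ℝ}
    (hk : ∀ r, HasDerivAt k (k' r) r) (y : ℝ × ℝ × F) :
    HasFDerivAt (fun z : ℝ × ℝ × F => k z.1) (baseForm (k' y.1) 0) y := by
  refine ((hk y.1).comp_hasFDerivAt y hasFDerivAt_fst).congr_fderiv ?_
  ext <;> simp

variable {h1 h2 p1 p2 : ℝ → ℝ} {qr qt qrr qrt qtt : ℝ → ℝ → ℝ}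

theorem fderiv_fourBlock (hh1 : ∀ r, HasDerivAt h (h1 r) r) (hp1 : ∀ r, HasDerivAt p (p1 r) r)
    (hq : ∀ y : ℝ × ℝ × V × W, HasFDerivAt (fun z : ℝ × ℝ × V × W => q z.1 z.2.1)
      (baseForm (qr y.1 y.2.1) (qt y.1 y.2.1)) y)
    (y u v w : ℝ × ℝ × V × W) :
    fderiv ℝ (fun z => fourBlock h p q z u v) y w =
      2 * h y.1 * h1 y.1 * w.1 * (u.2.1 * v.2.1)
        + 2 * p y.1 * p1 y.1 * w.1 * inner ℝ u.2.2.1 v.2.2.1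
        + 2 * q y.1 y.2.1 * (qr y.1 y.2.1 * w.1 + qt y.1 y.2.1 * w.2.1)
          * inner ℝ u.2.2.2 v.2.2.2 := by
  simp only [fourBlock_apply]
  rw [(((((hasFDerivAt_comp_fst hh1 y).pow 2).mul_const (u.2.1 * v.2.1)).const_add
    (u.1 * v.1)).fun_add (((hasFDerivAt_comp_fst hp1 y).pow 2).mul_const (inner ℝ u.2.2.1 v.2.2.1))
    |>.fun_add (((hq y).pow 2).mul_const (inner ℝ u.2.2.2 v.2.2.2))).fderiv]
  simp
  ring

theorem fderiv_fderiv_fourBlock (hh1 : ∀ r, HasDerivAt h (h1 r) r)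
    (hh2 : ∀ r, HasDerivAt h1 (h2 r) r)
    (hp1 : ∀ r, HasDerivAt p (p1 r) r) (hp2 : ∀ r, HasDerivAt p1 (p2 r) r)
    (hq : ∀ y : ℝ × ℝ × V × W, HasFDerivAt (fun z : ℝ × ℝ × V × W => q z.1 z.2.1)
      (baseForm (qr y.1 y.2.1) (qt y.1 y.2.1)) y)
    (hqr : ∀ y : ℝ × ℝ × V × W, HasFDerivAt (fun z : ℝ × ℝ × V × W => qr z.1 z.2.1)
      (baseForm (qrr y.1 y.2.1) (qrt y.1 y.2.1)) y)
    (hqt : ∀ y : ℝ × ℝ × V × W, HasFDerivAt (fun z : ℝ × ℝ × V × W => qt z.1 z.2.1)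
      (baseForm (qrt y.1 y.2.1) (qtt y.1 y.2.1)) y)
    (y u v w a : ℝ × ℝ × V × W) :
    fderiv ℝ (fun z => fderiv ℝ (fun z => fourBlock h p q z u v) z w) y a =
      2 * (h1 y.1 ^ 2 + h y.1 * h2 y.1) * a.1 * w.1 * (u.2.1 * v.2.1)
        + 2 * (p1 y.1 ^ 2 + p y.1 * p2 y.1) * a.1 * w.1 * inner ℝ u.2.2.1 v.2.2.1
        + 2 * ((qr y.1 y.2.1 * a.1 + qt y.1 y.2.1 * a.2.1)
              * (qr y.1 y.2.1 * w.1 + qt y.1 y.2.1 * w.2.1)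
            + q y.1 y.2.1 * (qrr y.1 y.2.1 * a.1 * w.1
              + qrt y.1 y.2.1 * (a.1 * w.2.1 + a.2.1 * w.1) + qtt y.1 y.2.1 * a.2.1 * w.2.1))
          * inner ℝ u.2.2.2 v.2.2.2 := by
  simp only [fderiv_fourBlock hh1 hp1 hq]
  rw [((((((hasFDerivAt_comp_fst hh1 y).const_mul 2).fun_mul (hasFDerivAt_comp_fst hh2 y)).mul_const
      w.1).mul_const (u.2.1 * v.2.1)).fun_add
    (((((hasFDerivAt_comp_fst hp1 y).const_mul 2).fun_mul (hasFDerivAt_comp_fst hp2 y)).mul_const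
      w.1).mul_const (inner ℝ u.2.2.1 v.2.2.1)) |>.fun_add
    ((((hq y).const_mul 2).fun_mul (((hqr y).mul_const w.1).fun_add ((hqt y).mul_const
      w.2.1))).mul_const (inner ℝ u.2.2.2 v.2.2.2))).fderiv]
  simp
  ring

variable [FiniteDimensional ℝ V] [FiniteDimensional ℝ W]

/-- The lowered form determines the Christoffel vector, so it suffices to check the proposed
components against it. -/
theorem christoffel_fourBlock (hh : ∀ r, 0 < h r) (hp : ∀ r, 0 < p r) (hq0 : ∀ r t, 0 < q r t)
    (hG : ContDiff ℝ ∞ (fourBlock (V := V) (W := W) h p q))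
    (hh1 : ∀ r, HasDerivAt h (h1 r) r) (hp1 : ∀ r, HasDerivAt p (p1 r) r)
    (hq : ∀ y : ℝ × ℝ × V × W, HasFDerivAt (fun z : ℝ × ℝ × V × W => q z.1 z.2.1)
      (baseForm (qr y.1 y.2.1) (qt y.1 y.2.1)) y)
    (y u v : ℝ × ℝ × V × W) :
    christoffel (fourBlock h p q) y u v =
      (-(h y.1 * h1 y.1 * (u.2.1 * v.2.1) + p y.1 * p1 y.1 * inner ℝ u.2.2.1 v.2.2.1
          + q y.1 y.2.1 * qr y.1 y.2.1 * inner ℝ u.2.2.2 v.2.2.2),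
        (h y.1 * h1 y.1 * (u.1 * v.2.1 + v.1 * u.2.1)
          - q y.1 y.2.1 * qt y.1 y.2.1 * inner ℝ u.2.2.2 v.2.2.2) / h y.1 ^ 2,
        (p1 y.1 / p y.1) • (u.1 • v.2.2.1 + v.1 • u.2.2.1),
        (q y.1 y.2.1)⁻¹ • ((qr y.1 y.2.1 * u.1 + qt y.1 y.2.1 * u.2.1) • v.2.2.2
          + (qr y.1 y.2.1 * v.1 + qt y.1 y.2.1 * v.2.1) • u.2.2.2)) := by
  refine christoffel_eq_of_form (fourBlock_pos hh hp hq0) hG fun w => ?_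
  have hn := (hh y.1).ne'
  have pn := (hp y.1).ne'
  have qn := (hq0 y.1 y.2.1).ne'
  simp only [fderiv_fourBlock hh1 hp1 hq]
  simp only [fourBlock_apply, inner_add_left, real_inner_smul_left]
  field_simp
  ring

/-- The entries `Qrr`, `Qrt - H1 / H * Qt` and `Qtt + H * H1 * Qr` are the Hessian of `q` for the
base metric `dr² + h² dt²`, and `Qr ^ 2 + Qt ^ 2 / H ^ 2` is its squared gradient. Values at the
point enter as free variables, so that what remains is an identity of rational functions. -/
theorem form_curvature_fourBlock (hh : ∀ r, 0 < h r) (hp : ∀ r, 0 < p r)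
    (hq0 : ∀ r t, 0 < q r t) (hG : ContDiff ℝ ∞ (fourBlock (V := V) (W := W) h p q))
    (hh1 : ∀ r, HasDerivAt h (h1 r) r) (hh2 : ∀ r, HasDerivAt h1 (h2 r) r)
    (hp1 : ∀ r, HasDerivAt p (p1 r) r) (hp2 : ∀ r, HasDerivAt p1 (p2 r) r)
    (hq : ∀ y : ℝ × ℝ × V × W, HasFDerivAt (fun z : ℝ × ℝ × V × W => q z.1 z.2.1)
      (baseForm (qr y.1 y.2.1) (qt y.1 y.2.1)) y)
    (hqr : ∀ y : ℝ × ℝ × V × W, HasFDerivAt (fun z : ℝ × ℝ × V × W => qr z.1 z.2.1)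
      (baseForm (qrr y.1 y.2.1) (qrt y.1 y.2.1)) y)
    (hqt : ∀ y : ℝ × ℝ × V × W, HasFDerivAt (fun z : ℝ × ℝ × V × W => qt z.1 z.2.1)
      (baseForm (qrt y.1 y.2.1) (qtt y.1 y.2.1)) y)
    (y u v : ℝ × ℝ × V × W) {H H1 H2 P P1 P2 Q Qr Qt Qrr Qrt Qtt a b c a' b' c' : ℝ}
    (eH : h y.1 = H) (eH1 : h1 y.1 = H1) (eH2 : h2 y.1 = H2)
    (eP : p y.1 = P) (eP1 : p1 y.1 = P1) (eP2 : p2 y.1 = P2)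
    (eQ : q y.1 y.2.1 = Q) (eQr : qr y.1 y.2.1 = Qr) (eQt : qt y.1 y.2.1 = Qt)
    (eQrr : qrr y.1 y.2.1 = Qrr) (eQrt : qrt y.1 y.2.1 = Qrt) (eQtt : qtt y.1 y.2.1 = Qtt)
    (ea : inner ℝ u.2.2.1 u.2.2.1 = a) (eb : inner ℝ u.2.2.1 v.2.2.1 = b)
    (ec : inner ℝ v.2.2.1 v.2.2.1 = c)
    (ea' : inner ℝ u.2.2.2 u.2.2.2 = a') (eb' : inner ℝ u.2.2.2 v.2.2.2 = b')
    (ec' : inner ℝ v.2.2.2 v.2.2.2 = c') :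
    fourBlock h p q y (curvature (fourBlock h p q) y u v v) u =
      -(H * H2 * (u.1 * v.2.1 - v.1 * u.2.1) ^ 2
        + P * (P2 * (u.1 ^ 2 * c - 2 * u.1 * v.1 * b + v.1 ^ 2 * a)
          + H * H1 * P1 * (u.2.1 ^ 2 * c - 2 * u.2.1 * v.2.1 * b + v.2.1 ^ 2 * a))
        + Q * (Qrr * (u.1 ^ 2 * c' - 2 * u.1 * v.1 * b' + v.1 ^ 2 * a')
          + 2 * (Qrt - H1 / H * Qt)
            * (u.1 * u.2.1 * c' - (u.1 * v.2.1 + v.1 * u.2.1) * b' + v.1 * v.2.1 * a')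
          + (Qtt + H * H1 * Qr) * (u.2.1 ^ 2 * c' - 2 * u.2.1 * v.2.1 * b' + v.2.1 ^ 2 * a'))
        + P ^ 2 * P1 ^ 2 * (a * c - b ^ 2)
        + Q ^ 2 * (Qr ^ 2 + Qt ^ 2 / H ^ 2) * (a' * c' - b' ^ 2)
        + P * Q * P1 * Qr * (a * c' + c * a' - 2 * b * b')) := by
  refine (form_curvature (G := fourBlock h p q) (fourBlock_pos hh hp hq0) fourBlock_symm hG
    y u v).trans ?_
  have hn := (hh y.1).ne'
  have pn := (hp y.1).ne'
  have qn := (hq0 y.1 y.2.1).ne'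
  have eb2 : inner ℝ v.2.2.1 u.2.2.1 = b := by rw [real_inner_comm, eb]
  have eb2' : inner ℝ v.2.2.2 u.2.2.2 = b' := by rw [real_inner_comm, eb']
  simp only [fderiv_fderiv_fourBlock hh1 hh2 hp1 hp2 hq hqr hqt,
    christoffel_fourBlock hh hp hq0 hG hh1 hp1 hq]
  simp only [fourBlock_apply, inner_add_left,
    inner_add_right, real_inner_smul_left, real_inner_smul_right, eH, eH1, eH2, eP, eP1, eP2,
    eQ, eQr, eQt, eQrr, eQrt, eQtt, ea, eb, ec, ea', eb', ec', eb2, eb2']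
  rw [eH] at hn
  rw [eP] at pn
  rw [eQ] at qn
  field_simp
  ring

end FourBlocks

end RiemVS

/-! ### Curvature of the three-block slice metric -/

namespace RiemVS

variable {V W : Type*} [NormedAddCommGroup V] [InnerProductSpace ℝ V]
  [NormedAddCommGroup W] [InnerProductSpace ℝ W]

section ThreeBlocks

set_option maxSynthPendingDepth 5

/-- The metric `dt² + k² dρ² + q² dτ²` on `ℝ × V × W`. -/
def threeBlock (k : ℝ) (q : ℝ → ℝ) (z : ℝ × V × W) :
    (ℝ × V × W) →L[ℝ] (ℝ × V × W) →L[ℝ] ℝ :=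
  pullInner (.fst ℝ ℝ (V × W)) + k ^ 2 • pullInner (.fst ℝ V W ∘L .snd ℝ ℝ (V × W))
    + q z.1 ^ 2 • pullInner (.snd ℝ V W ∘L .snd ℝ ℝ (V × W))

variable {k : ℝ} {q : ℝ → ℝ}

theorem threeBlock_apply (z v w : ℝ × V × W) :
    threeBlock k q z v w = v.1 * w.1 + k ^ 2 * inner ℝ v.2.1 w.2.1
      + q z.1 ^ 2 * inner ℝ v.2.2 w.2.2 := by
  simp [threeBlock, mul_comm]

theorem threeBlock_symm (z v w : ℝ × V × W) :
    threeBlock k q z v w = threeBlock k q z w v := by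
  rw [threeBlock_apply, threeBlock_apply, real_inner_comm, real_inner_comm w.2.2]
  ring

theorem threeBlock_pos (hk : 0 < k) (hq : ∀ t, 0 < q t) (z v : ℝ × V × W) (hv : v ≠ 0) :
    0 < threeBlock k q z v v := by
  rw [threeBlock_apply]
  have h3 := pow_pos hk 2
  have h4 := pow_pos (hq z.1) 2
  have i3 := real_inner_self_nonneg (x := v.2.1)
  have i4 := real_inner_self_nonneg (x := v.2.2)
  have n1 := mul_self_nonneg v.1
  have n3 := mul_nonneg h3.le i3
  have n4 := mul_nonneg h4.le i4
  by_contra hle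
  have z1 : v.1 = 0 := mul_self_eq_zero.1 (by linarith)
  have z3 : v.2.1 = 0 := inner_self_eq_zero.1
    ((mul_eq_zero_iff_left h3.ne').1 (by linarith : k ^ 2 * inner ℝ v.2.1 v.2.1 = 0))
  have z4 : v.2.2 = 0 := inner_self_eq_zero.1
    ((mul_eq_zero_iff_left h4.ne').1 (by linarith : q z.1 ^ 2 * inner ℝ v.2.2 v.2.2 = 0))
  exact hv (Prod.ext z1 (Prod.ext z3 z4))

theorem contDiff_threeBlock (hq : ContDiff ℝ ∞ q) :
    ContDiff ℝ ∞ (threeBlock (V := V) (W := W) k q) := by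
  unfold threeBlock
  exact contDiff_const.add (((hq.comp contDiff_fst).pow 2).smul contDiff_const)

theorem hasFDerivAt_comp_fst' {F : Type*} [NormedAddCommGroup F] [NormedSpace ℝ F] {f f' : ℝ → ℝ}
    (hf : ∀ t, HasDerivAt f (f' t) t) (z : ℝ × F) :
    HasFDerivAt (fun x : ℝ × F => f x.1) (f' z.1 • ContinuousLinearMap.fst ℝ ℝ F) z :=
  (hf z.1).comp_hasFDerivAt z hasFDerivAt_fst

variable {q1 q2 : ℝ → ℝ}

theorem fderiv_threeBlock (hq : ∀ t, HasDerivAt q (q1 t) t) (z u v w : ℝ × V × W) :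
    fderiv ℝ (fun z => threeBlock k q z u v) z w =
      2 * q z.1 * q1 z.1 * w.1 * inner ℝ u.2.2 v.2.2 := by
  simp only [threeBlock_apply]
  rw [((((hasFDerivAt_comp_fst' hq z).pow 2).mul_const (inner ℝ u.2.2 v.2.2)).const_add
    (u.1 * v.1 + k ^ 2 * inner ℝ u.2.1 v.2.1)).fderiv]
  simp
  ring

theorem fderiv_fderiv_threeBlock (hq : ∀ t, HasDerivAt q (q1 t) t)
    (hq1 : ∀ t, HasDerivAt q1 (q2 t) t) (z u v w a : ℝ × V × W) :
    fderiv ℝ (fun z => fderiv ℝ (fun z => threeBlock k q z u v) z w) z a =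
      2 * (q1 z.1 ^ 2 + q z.1 * q2 z.1) * a.1 * w.1 * inner ℝ u.2.2 v.2.2 := by
  simp only [fderiv_threeBlock hq]
  rw [(((((hasFDerivAt_comp_fst' hq z).const_mul 2).fun_mul
    (hasFDerivAt_comp_fst' hq1 z)).mul_const w.1).mul_const (inner ℝ u.2.2 v.2.2)).fderiv]
  simp
  ring

variable [FiniteDimensional ℝ V] [FiniteDimensional ℝ W]

theorem christoffel_threeBlock (hk : 0 < k) (hq0 : ∀ t, 0 < q t)
    (hG : ContDiff ℝ ∞ (threeBlock (V := V) (W := W) k q))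
    (hq : ∀ t, HasDerivAt q (q1 t) t) (z u v : ℝ × V × W) :
    christoffel (threeBlock k q) z u v =
      (-(q z.1 * q1 z.1 * inner ℝ u.2.2 v.2.2), 0,
        (q1 z.1 / q z.1) • (u.1 • v.2.2 + v.1 • u.2.2)) := by
  refine christoffel_eq_of_form (threeBlock_pos hk hq0) hG fun w => ?_
  have qn := (hq0 z.1).ne'
  simp only [fderiv_threeBlock hq]
  simp only [threeBlock_apply, inner_add_left, real_inner_smul_left, inner_zero_left]
  field_simp
  ring

theorem form_curvature_threeBlock (hk : 0 < k) (hq0 : ∀ t, 0 < q t)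
    (hG : ContDiff ℝ ∞ (threeBlock (V := V) (W := W) k q))
    (hq : ∀ t, HasDerivAt q (q1 t) t) (hq1 : ∀ t, HasDerivAt q1 (q2 t) t)
    (z u v : ℝ × V × W) :
    threeBlock k q z (curvature (threeBlock k q) z u v v) u =
      -(q z.1 * q2 z.1 * ‖u.1 • v.2.2 - v.1 • u.2.2‖ ^ 2
        + q z.1 ^ 2 * q1 z.1 ^ 2 * (‖u.2.2‖ ^ 2 * ‖v.2.2‖ ^ 2 - inner ℝ u.2.2 v.2.2 ^ 2)) := by
  refine (form_curvature (G := threeBlock k q) (threeBlock_pos hk hq0) threeBlock_symm hG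
    z u v).trans ?_
  have qn := (hq0 z.1).ne'
  simp only [fderiv_fderiv_threeBlock hq hq1, christoffel_threeBlock hk hq0 hG hq]
  simp only [threeBlock_apply, ← real_inner_self_eq_norm_sq, inner_add_left, inner_sub_left,
    inner_sub_right, inner_add_right, real_inner_smul_left, real_inner_smul_right,
    inner_zero_left]
  rw [real_inner_comm u.2.2 v.2.2]
  generalize (inner ℝ u.2.2 v.2.2 : ℝ) = b
  generalize (inner ℝ u.2.2 u.2.2 : ℝ) = a
  generalize (inner ℝ v.2.2 v.2.2 : ℝ) = c
  field_simp
  ring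

end ThreeBlocks

end RiemVS

/-! ### The smoothed profile `f` and its derivatives -/

namespace WarpedModel

namespace Profile

variable (D : Profile)

/-- `1 - ∫_{-1}^x λ`. -/
def tail (x : ℝ) : ℝ := 1 - ∫ t in (-1 : ℝ)..x, D.lam t

/-- `∫_{-1}^x e^{-s} λ(s) ds`. -/
def expMass (x : ℝ) : ℝ := ∫ t in (-1 : ℝ)..x, Real.exp (-t) * D.lam t

theorem lam_continuous : Continuous D.lam := D.lam_smooth.continuous

theorem lam_eq_zero {x : ℝ} (hx : x ∉ Icc (-1 : ℝ) 1) : D.lam x = 0 := by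
  by_contra h
  exact hx (D.lam_support h)

/-- The support condition leaves the endpoint open; continuity settles it. -/
theorem lam_eq_zero_of_le {x : ℝ} (hx : x ≤ -1) : D.lam x = 0 := by
  have h : closure (Iio (-1 : ℝ)) ⊆ {x | D.lam x = 0} :=
    closure_minimal (fun y hy => D.lam_eq_zero fun h => absurd h.1 (not_le.2 hy))
      (isClosed_eq D.lam_continuous continuous_const)
  rw [closure_Iio] at h
  exact h hx

theorem lam_eq_zero_of_ge {x : ℝ} (hx : 1 ≤ x) : D.lam x = 0 := by
  have h : closure (Ioi (1 : ℝ)) ⊆ {x | D.lam x = 0} :=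
    closure_minimal (fun y hy => D.lam_eq_zero fun h => absurd h.2 (not_le.2 hy))
      (isClosed_eq D.lam_continuous continuous_const)
  rw [closure_Ioi] at h
  exact h hx

theorem integrable_mul_lam {φ : ℝ → ℝ} (hφ : Continuous φ) :
    Integrable fun s => φ s * D.lam s :=
  (hφ.mul D.lam_continuous).integrable_of_hasCompactSupport
    (HasCompactSupport.of_support_subset_isCompact isCompact_Icc
      ((Function.support_mul_subset_right _ _).trans D.lam_support))

theorem integral_Iic_mul_lam (φ : ℝ → ℝ) (hφ : Continuous φ) (x : ℝ) :
    ∫ s in Iic x, φ s * D.lam s = ∫ s in (-1 : ℝ)..x, φ s * D.lam s := by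
  have h0 : ∫ s in Iic (-1 : ℝ), φ s * D.lam s = 0 :=
    setIntegral_eq_zero_of_forall_eq_zero fun s hs => by rw [D.lam_eq_zero_of_le hs, mul_zero]
  rw [← intervalIntegral.integral_Iic_sub_Iic (D.integrable_mul_lam hφ).integrableOn
    (D.integrable_mul_lam hφ).integrableOn, h0, sub_zero]

theorem integral_lam : ∫ s, D.lam s = 1 := by
  rw [← D.lam_integral, intervalIntegral.integral_of_le (by norm_num)]
  symm
  apply setIntegral_eq_integral_of_forall_compl_eq_zero
  intro s hs
  rw [mem_Ioc, not_and_or, not_lt, not_le] at hs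
  rcases hs with h | h
  exacts [D.lam_eq_zero_of_le h, D.lam_eq_zero_of_ge h.le]

/-- After reflecting the convolution, the integral of `fbar (x - s) * λ s` splits at `s = x`: beyond
`x` the factor is 1, before `x` it is `e^x e^{-s}`. Smoothness of `f`, the relations `f' = f - tail`
and `f'' = f' + λ`, and the shape of `f` outside `[-1, 1]` all come from this formula. -/
theorem f_eq (x : ℝ) : D.f x = D.tail x + Real.exp x * D.expMass x := by
  have h1 : D.f x = ∫ s, fbar (x - s) * D.lam s := by
    unfold f conv
    rw [← integral_sub_left_eq_self (fun t => fbar t * D.lam (x - t)) volume x]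
    simp
  have hint : Integrable fun s => fbar (x - s) * D.lam s := by
    have e : (fun s => fbar (x - s) * D.lam s) = fun s =>
        (Ici x).indicator (fun s => 1 * D.lam s) s
          + (Iio x).indicator (fun s => Real.exp (x - s) * D.lam s) s := by
      funext s
      by_cases h : x ≤ s
      · simp [fbar, h]
      · simp [fbar, h, not_le.1 h]
    rw [e]
    exact ((D.integrable_mul_lam continuous_const).indicator measurableSet_Ici).add
      ((D.integrable_mul_lam (by fun_prop)).indicator measurableSet_Iio)
  rw [h1, ← integral_add_compl measurableSet_Iic hint (s := Iic x), compl_Iic]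
  have e1 : ∫ s in Iic x, fbar (x - s) * D.lam s = Real.exp x * D.expMass x := by
    unfold expMass
    rw [← D.integral_Iic_mul_lam (fun s => Real.exp (-s)) (by fun_prop), ← integral_const_mul]
    refine setIntegral_congr_fun measurableSet_Iic fun s hs => ?_
    simp only [mem_Iic] at hs
    rcases hs.lt_or_eq with h | rfl
    · simp only [fbar, if_neg (not_le.2 (sub_pos.2 h))]
      rw [sub_eq_add_neg, Real.exp_add, mul_assoc]
    · simp only [fbar, sub_self, le_refl, if_true, ← mul_assoc, ← Real.exp_add]
      simp
  have e2 : ∫ s in Ioi x, fbar (x - s) * D.lam s = D.tail x := by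
    have h2 := integral_add_compl measurableSet_Iic
      (D.integrable_mul_lam (φ := fun _ => 1) continuous_const) (s := Iic x)
    rw [D.integral_Iic_mul_lam _ continuous_const, compl_Iic] at h2
    simp only [one_mul, D.integral_lam] at h2
    rw [tail, ← eq_sub_iff_add_eq'.2 h2]
    refine setIntegral_congr_fun measurableSet_Ioi fun s hs => ?_
    simp [fbar, le_of_lt (mem_Ioi.1 hs)]
  rw [e1, e2, add_comm]

theorem hasDerivAt_tail (x : ℝ) : HasDerivAt D.tail (-D.lam x) x := by
  have := (D.lam_continuous.integral_hasStrictDerivAt (-1) x).hasDerivAt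
  exact this.const_sub 1

theorem hasDerivAt_expMass (x : ℝ) : HasDerivAt D.expMass (Real.exp (-x) * D.lam x) x :=
  (Continuous.integral_hasStrictDerivAt (f := fun t => Real.exp (-t) * D.lam t)
    ((Real.continuous_exp.comp continuous_neg).mul D.lam_continuous) (-1) x).hasDerivAt

/-- The derivative of `f`. -/
def f1 (x : ℝ) : ℝ := D.f x - D.tail x

theorem f1_eq (x : ℝ) : D.f1 x = Real.exp x * D.expMass x := by
  rw [f1, f_eq]; ring

theorem hasDerivAt_f1 (x : ℝ) : HasDerivAt D.f1 (D.f1 x + D.lam x) x := by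
  rw [funext D.f1_eq]
  refine ((Real.hasDerivAt_exp x).fun_mul (D.hasDerivAt_expMass x)).congr_deriv ?_
  rw [← mul_assoc, ← Real.exp_add]
  simp

theorem hasDerivAt_f (x : ℝ) : HasDerivAt D.f (D.f1 x) x := by
  have e : D.f = fun x => D.tail x + D.f1 x := by
    funext y; rw [f1]; ring
  rw [e]
  refine ((D.hasDerivAt_tail x).fun_add (D.hasDerivAt_f1 x)).congr_deriv ?_
  ring

theorem contDiff_of_hasDerivAt {g g' : ℝ → ℝ} (h : ∀ x, HasDerivAt g (g' x) x)
    (hg : ContDiff ℝ ∞ g') : ContDiff ℝ ∞ g := by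
  rw [contDiff_infty_iff_deriv]
  exact ⟨fun x => (h x).differentiableAt, by rwa [funext fun x => (h x).deriv]⟩

theorem f_smooth : ContDiff ℝ ∞ D.f := by
  have h1 : ContDiff ℝ ∞ D.tail := contDiff_of_hasDerivAt D.hasDerivAt_tail D.lam_smooth.neg
  have h2 : ContDiff ℝ ∞ D.expMass := contDiff_of_hasDerivAt D.hasDerivAt_expMass
    ((Real.contDiff_exp.comp contDiff_neg).mul D.lam_smooth)
  rw [funext D.f_eq]
  exact h1.add (Real.contDiff_exp.mul h2)

theorem tail_of_le {x : ℝ} (hx : x ≤ -1) : D.tail x = 1 := by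
  have : ∫ t in (-1 : ℝ)..x, D.lam t = 0 := by
    rw [intervalIntegral.integral_symm, intervalIntegral.integral_of_le hx,
      setIntegral_eq_zero_of_forall_eq_zero, neg_zero]
    exact fun t ht => D.lam_eq_zero_of_le ht.2
  simp [tail, this]

theorem tail_of_ge {x : ℝ} (hx : 1 ≤ x) : D.tail x = 0 := by
  have h : ∫ t in (1 : ℝ)..x, D.lam t = 0 := by
    rw [intervalIntegral.integral_of_le hx, setIntegral_eq_zero_of_forall_eq_zero]
    exact fun t ht => D.lam_eq_zero_of_ge ht.1.le
  rw [tail, ← intervalIntegral.integral_add_adjacent_intervals (b := 1)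
    (D.lam_continuous.intervalIntegrable _ _) (D.lam_continuous.intervalIntegrable _ _), h,
    D.lam_integral]
  norm_num

theorem tail_antitone : Antitone D.tail :=
  antitone_of_deriv_nonpos (fun x => (D.hasDerivAt_tail x).differentiableAt) fun x => by
    rw [(D.hasDerivAt_tail x).deriv]
    linarith [D.lam_nonneg x]

theorem tail_nonneg (x : ℝ) : 0 ≤ D.tail x := by
  rcases le_total 1 x with h | h
  · exact (D.tail_of_ge h).ge
  · exact (D.tail_of_ge le_rfl).ge.trans (D.tail_antitone h)

theorem tail_le_one (x : ℝ) : D.tail x ≤ 1 := by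
  rcases le_total x (-1) with h | h
  · exact (D.tail_of_le h).le
  · exact (D.tail_antitone h).trans (D.tail_of_le le_rfl).le

theorem expMass_of_le {x : ℝ} (hx : x ≤ -1) : D.expMass x = 0 := by
  rw [expMass, intervalIntegral.integral_symm, intervalIntegral.integral_of_le hx,
    setIntegral_eq_zero_of_forall_eq_zero, neg_zero]
  exact fun t ht => by rw [D.lam_eq_zero_of_le ht.2, mul_zero]

theorem expMass_monotone : Monotone D.expMass :=
  monotone_of_deriv_nonneg (fun x => (D.hasDerivAt_expMass x).differentiableAt) fun x => by
    rw [(D.hasDerivAt_expMass x).deriv]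
    exact mul_nonneg (Real.exp_pos _).le (D.lam_nonneg x)

theorem expMass_of_ge {x : ℝ} (hx : 1 ≤ x) : D.expMass x = D.c := by
  have h1 : D.c = ∫ s, Real.exp (-s) * D.lam s := by
    unfold c conv
    rw [← integral_neg_eq_self]
    simp
  rw [h1, expMass, ← D.integral_Iic_mul_lam (fun s => Real.exp (-s)) (by fun_prop)]
  apply setIntegral_eq_integral_of_forall_compl_eq_zero
  intro s hs
  rw [D.lam_eq_zero_of_ge (hx.trans (not_le.1 hs).le), mul_zero]

theorem expMass_nonneg (x : ℝ) : 0 ≤ D.expMass x := by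
  rcases le_total x (-1) with h | h
  · exact (D.expMass_of_le h).ge
  · exact (D.expMass_of_le le_rfl).ge.trans (D.expMass_monotone h)

theorem expMass_le (x : ℝ) : D.expMass x ≤ D.c := by
  rcases le_total 1 x with h | h
  · exact (D.expMass_of_ge h).le
  · exact (D.expMass_monotone h).trans (D.expMass_of_ge le_rfl).le

theorem c_nonneg : 0 ≤ D.c := (D.expMass_nonneg 0).trans (D.expMass_le 0)

theorem f1_nonneg (x : ℝ) : 0 ≤ D.f1 x := by
  rw [f1_eq]
  exact mul_nonneg (Real.exp_pos x).le (D.expMass_nonneg x)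

theorem f_of_le {x : ℝ} (hx : x ≤ -1) : D.f x = 1 := by
  rw [f_eq, D.tail_of_le hx, D.expMass_of_le hx]; simp

theorem f_of_ge {x : ℝ} (hx : 1 ≤ x) : D.f x = D.c * Real.exp x := by
  rw [f_eq, D.tail_of_ge hx, D.expMass_of_ge hx]; ring

theorem f_ge_one (x : ℝ) : 1 ≤ D.f x := by
  have hm : Monotone D.f :=
    monotone_of_deriv_nonneg (fun x => (D.hasDerivAt_f x).differentiableAt) fun x => by
      rw [(D.hasDerivAt_f x).deriv]
      exact D.f1_nonneg x
  rcases le_total x (-1) with h | h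
  · exact (D.f_of_le h).ge
  · exact (D.f_of_le le_rfl).ge.trans (hm h)

/-- Global growth bound, needed for the volume estimate. -/
theorem f_le (x : ℝ) : D.f x ≤ 1 + D.c * Real.exp x := by
  rw [f_eq, mul_comm D.c]
  exact add_le_add (D.tail_le_one x)
    (mul_le_mul_of_nonneg_left (D.expMass_le x) (Real.exp_pos x).le)

theorem exists_lam_le : ∃ M : ℝ, 0 < M ∧ ∀ x, D.lam x ≤ M := by
  obtain ⟨M, hM⟩ := isCompact_Icc.exists_bound_of_continuousOn
    (D.lam_continuous.continuousOn (s := Icc (-1) 1))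
  refine ⟨max M 1, by positivity, fun x => ?_⟩
  by_cases hx : x ∈ Icc (-1 : ℝ) 1
  · exact ((le_abs_self _).trans (hM x hx)).trans (le_max_left _ _)
  · rw [D.lam_eq_zero hx]; positivity

end Profile

end WarpedModel

/-! ### Existence of admissible triples -/

namespace WarpedModel

/-- A smooth convex replacement of `x ↦ max (x - c) 0`. -/
theorem exists_smooth_ramp (c : ℝ) {ε δ : ℝ} (hε : 0 < ε) (hεδ : ε < δ) :
    ∃ g g' g'' : ℝ → ℝ, ContDiff ℝ ∞ g ∧ (∀ x, HasDerivAt g (g' x) x) ∧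
      (∀ x, HasDerivAt g' (g'' x) x) ∧ (∀ x ≤ c - δ, g x = 0) ∧ (∀ x, c + δ ≤ x → g x = x - c) ∧
      (∀ x, 0 ≤ g x) ∧ (∀ x, 0 ≤ g' x) ∧ (∀ x ∈ Ioo (c - δ) (c + δ), g' x < 1) ∧
      (∀ x, 0 ≤ g'' x) ∧ ∀ x, g'' x ≤ 1 / (2 * ε) := by
  let χ : ContDiffBump c := ⟨ε, δ, hε, hεδ⟩
  have hδ : 0 < δ := hε.trans hεδ
  set β : ℝ → ℝ := χ.normed volume with hβ
  have βs : ContDiff ℝ ∞ β := χ.contDiff_normed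
  have βc : Continuous β := βs.continuous
  have β0 : ∀ x, 0 ≤ β x := χ.nonneg_normed
  have βsupp : Function.support β = Ioo (c - δ) (c + δ) := by
    rw [hβ, χ.support_normed_eq, Real.ball_eq_Ioo]
  have βz : ∀ x, x ∉ Ioo (c - δ) (c + δ) → β x = 0 := fun x hx => by
    rwa [← Function.notMem_support, βsupp]
  -- Symmetry of the bump about `c` makes the integral `g` of its distribution function `B` equal to
  -- exactly `x - c` on the right.
  have βsymm : ∀ x, β (2 * c - x) = β x := fun x => by
    have := χ.normed_sub (μ := volume) (x - c)
    rw [show c - (x - c) = 2 * c - x by ring, show c + (x - c) = x by ring] at this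
    exact this
  set B : ℝ → ℝ := fun x => ∫ t in (c - δ)..x, β t with hB
  have dB : ∀ x, HasDerivAt B (β x) x := fun x =>
    (βc.integral_hasStrictDerivAt (c - δ) x).hasDerivAt
  have Bs : ContDiff ℝ ∞ B := Profile.contDiff_of_hasDerivAt dB βs
  have Bl : ∀ x ≤ c - δ, B x = 0 := fun x hx => by
    simp only [hB]
    rw [intervalIntegral.integral_symm, intervalIntegral.integral_of_le hx,
      setIntegral_eq_zero_of_forall_eq_zero, neg_zero]
    exact fun t ht => βz t fun h => absurd h.1 (not_lt.2 ht.2)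
  have Br : ∀ x, c + δ ≤ x → B x = 1 := fun x hx => by
    simp only [hB]
    rw [intervalIntegral.integral_of_le (by linarith), ← χ.integral_normed (μ := volume)]
    apply setIntegral_eq_integral_of_forall_compl_eq_zero
    exact fun t ht => βz t fun h => ht ⟨h.1, h.2.le.trans hx⟩
  have Bmono : Monotone B :=
    monotone_of_deriv_nonneg (fun x => (dB x).differentiableAt) fun x => by
      rw [(dB x).deriv]; exact β0 x
  have B0 : ∀ x, 0 ≤ B x := fun x => by
    rcases le_total x (c - δ) with h | h
    · exact (Bl x h).ge
    · exact (Bl _ le_rfl).ge.trans (Bmono h)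
  have Bco : ∀ x, ∫ t in x..(c + δ), β t = 1 - B x := fun x => by
    have h := intervalIntegral.integral_add_adjacent_intervals (μ := volume)
      (βc.intervalIntegrable (c - δ) x) (βc.intervalIntegrable x (c + δ))
    have h1 : ∫ t in (c - δ)..(c + δ), β t = 1 := Br _ le_rfl
    rw [h1] at h
    simp only [hB]
    linarith
  have Bsymm : ∀ x, B (2 * c - x) = 1 - B x := fun x => by
    rw [← Bco]
    have h := intervalIntegral.integral_comp_sub_left (a := x) (b := c + δ) β (2 * c)
    simp only [βsymm] at h
    rw [h]
    simp only [hB]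
    congr 1
    ring
  have B1 : ∀ x ∈ Ioo (c - δ) (c + δ), B x < 1 := fun x hx => by
    have : 0 < ∫ t in x..(c + δ), β t := by
      apply intervalIntegral.intervalIntegral_pos_of_pos_on (βc.intervalIntegrable _ _) _ hx.2
      intro t ht
      refine lt_of_le_of_ne (β0 t) (Ne.symm ?_)
      rw [← Function.mem_support, βsupp]
      exact ⟨hx.1.trans ht.1, ht.2⟩
    rw [Bco] at this
    linarith
  set g : ℝ → ℝ := fun x => ∫ t in (c - δ)..x, B t with hg
  have Bc : Continuous B := Bs.continuous
  have dg : ∀ x, HasDerivAt g (B x) x := fun x =>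
    (Bc.integral_hasStrictDerivAt (c - δ) x).hasDerivAt
  have gl : ∀ x ≤ c - δ, g x = 0 := fun x hx => by
    simp only [hg]
    rw [intervalIntegral.integral_symm, intervalIntegral.integral_of_le hx,
      setIntegral_eq_zero_of_forall_eq_zero, neg_zero]
    exact fun t ht => Bl t ht.2
  have gmono : Monotone g :=
    monotone_of_deriv_nonneg (fun x => (dg x).differentiableAt) fun x => by
      rw [(dg x).deriv]; exact B0 x
  -- Reflection gives `B (2c - x) = 1 - B x`, so `B` has mean `1/2` over an interval of length `2δ`.
  have gmid : ∫ t in (c - δ)..(c + δ), B t = δ := by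
    have h := intervalIntegral.integral_comp_sub_left (a := c - δ) (b := c + δ) B (2 * c)
    simp only [Bsymm] at h
    rw [intervalIntegral.integral_sub (by simp) (Bc.intervalIntegrable _ _)] at h
    rw [show 2 * c - (c + δ) = c - δ by ring, show 2 * c - (c - δ) = c + δ by ring] at h
    simp only [intervalIntegral.integral_const, smul_eq_mul, mul_one] at h
    linarith
  have gr : ∀ x, c + δ ≤ x → g x = x - c := fun x hx => by
    have h : ∫ t in (c + δ)..x, B t = x - (c + δ) := by
      rw [intervalIntegral.integral_congr (g := fun _ => (1 : ℝ))]
      · simp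
      · intro t ht
        rw [uIcc_of_le hx] at ht
        exact Br t ht.1
    simp only [hg]
    rw [← intervalIntegral.integral_add_adjacent_intervals (b := c + δ)
      (Bc.intervalIntegrable _ _) (Bc.intervalIntegrable _ _), h, gmid]
    ring
  refine ⟨g, B, β, Profile.contDiff_of_hasDerivAt dg Bs, dg, dB, gl, gr, fun x => ?_, B0, B1, β0,
    fun x => ?_⟩
  · rcases le_total x (c - δ) with h | h
    · exact (gl x h).ge
    · exact (gl _ le_rfl).ge.trans (gmono h)
  -- The bump equals 1 on the inner ball of length `2ε`, so its normalization is at most `1 / (2ε)`.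
  · have := χ.normed_le_div_measure_closedBall_rIn (μ := volume) x
    rwa [Measure.real, Real.volume_closedBall, ENNReal.toReal_ofReal (by positivity)] at this

theorem nonempty_profile : Nonempty Profile := by
  -- For `R = r - g`: the ramp bends on `[1, 5]`, and `ε = 1` gives `g'' ≤ 1/2`.
  obtain ⟨g, g', g'', gs, dg, dg', gl, gr, -, -, g1, g2, g3⟩ :=
    exists_smooth_ramp 3 (ε := 1) (δ := 2) one_pos one_lt_two
  -- For `h = e^r + 1 + k(e^r)`: the ramp bends for `e^r` between `1/2` and `3/2`. Since `e ≥ 2`,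
  -- this happens strictly inside `-1 < r < 1`; beyond it `k(e^r) = e^r - 1`.
  obtain ⟨k, k', k'', ks, dk, dk', kl, kr, k0, k1, -, k2, -⟩ :=
    exists_smooth_ramp 1 (ε := 1 / 4) (δ := 1 / 2) (by norm_num) (by norm_num)
  let χ : ContDiffBump (0 : ℝ) := ⟨1 / 2, 1, by norm_num, by norm_num⟩
  have hsupp : Function.support (χ.normed volume) = Ioo (-1) 1 := by
    rw [χ.support_normed_eq, Real.ball_eq_Ioo]; simp [χ]
  have dR : ∀ r, HasDerivAt (fun r => r - g r) (1 - g' r) r := fun r =>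
    (hasDerivAt_id r).sub (dg r)
  have dR' : deriv (fun r => r - g r) = fun r => 1 - g' r := funext fun r => (dR r).deriv
  have dR2 : ∀ r, deriv (deriv fun r => r - g r) r = -g'' r := fun r => by
    rw [dR']
    exact ((dg' r).const_sub 1).deriv
  have dh : ∀ r, HasDerivAt (fun r => Real.exp r + 1 + k (Real.exp r))
      (Real.exp r + k' (Real.exp r) * Real.exp r) r := fun r =>
    ((Real.hasDerivAt_exp r).add_const 1).add ((dk _).comp r (Real.hasDerivAt_exp r))
  have dh' : ∀ r, HasDerivAt (fun r => Real.exp r + k' (Real.exp r) * Real.exp r)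
      (Real.exp r + (k'' (Real.exp r) * Real.exp r * Real.exp r +
        k' (Real.exp r) * Real.exp r)) r := fun r => (Real.hasDerivAt_exp r).add
      (((dk' _).comp r (Real.hasDerivAt_exp r)).mul (Real.hasDerivAt_exp r))
  have eh : deriv (fun r => Real.exp r + 1 + k (Real.exp r)) =
    fun r => Real.exp r + k' (Real.exp r) * Real.exp r := funext fun r => (dh r).deriv
  have e1 : (2 : ℝ) ≤ Real.exp 1 := by have := Real.add_one_le_exp (1 : ℝ); linarith
  exact ⟨{
    R := fun r => r - g r
    h := fun r => Real.exp r + 1 + k (Real.exp r)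
    lam := χ.normed volume
    R_smooth := contDiff_id.sub gs
    R_left := fun r hr => by rw [gl r (by linarith), sub_zero]
    R_right := fun r hr => by rw [gr r (by linarith)]; ring
    R_deriv_pos := fun r hr => by
      rw [(dR r).deriv]
      have := g1 r ⟨by linarith [hr.1], by linarith [hr.2]⟩
      linarith
    R_deriv2_ge := fun r => by rw [dR2]; linarith [g3 r]
    R_deriv2_nonpos := fun r => by rw [dR2]; linarith [g2 r]
    lam_smooth := χ.contDiff_normed
    lam_nonneg := χ.nonneg_normed
    lam_support := hsupp.subset.trans Ioo_subset_Icc_self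
    lam_integral := by
      rw [intervalIntegral.integral_of_le (by norm_num)]
      refine (setIntegral_eq_integral_of_forall_compl_eq_zero fun x hx => ?_).trans
        χ.integral_normed
      by_contra h
      have h2 : x ∈ Function.support (χ.normed volume) := h
      rw [hsupp] at h2
      exact hx ⟨h2.1, h2.2.le⟩
    h_smooth := (Real.contDiff_exp.add contDiff_const).add (ks.comp Real.contDiff_exp)
    h_left := fun r hr => by
      have h1 : Real.exp r * Real.exp 1 ≤ 1 := by
        rw [← Real.exp_add]; exact Real.exp_le_one_iff.2 (by linarith)
      have h2 := Real.exp_pos r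
      rw [kl _ (by nlinarith)]; ring
    h_right := fun r hr => by
      have := Real.exp_le_exp.2 hr
      rw [kr _ (by linarith)]; ring
    h_ge_one := fun r => by linarith [k0 (Real.exp r), Real.exp_pos r]
    h_deriv_pos := fun r => by
      rw [eh]
      have := Real.exp_pos r
      have := k1 (Real.exp r)
      positivity
    h_deriv2_pos := fun r => by
      rw [eh, (dh' r).deriv]
      have := Real.exp_pos r
      have := k1 (Real.exp r)
      have := k2 (Real.exp r)
      positivity }⟩

end WarpedModel

/-! ### Derivatives of `R`, `h` and the warping functions -/

namespace WarpedModel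

namespace Profile

variable (D : Profile)

theorem hasDerivAt_h (r : ℝ) : HasDerivAt D.h (deriv D.h r) r :=
  (D.h_smooth.differentiable (by simp) r).hasDerivAt

theorem contDiff_deriv_h : ContDiff ℝ ∞ (deriv D.h) := (contDiff_infty_iff_deriv.1 D.h_smooth).2

theorem hasDerivAt_deriv_h (r : ℝ) : HasDerivAt (deriv D.h) (deriv (deriv D.h) r) r :=
  (D.contDiff_deriv_h.differentiable (by simp) r).hasDerivAt

theorem hasDerivAt_R (r : ℝ) : HasDerivAt D.R (deriv D.R r) r :=
  (D.R_smooth.differentiable (by simp) r).hasDerivAt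

theorem contDiff_deriv_R : ContDiff ℝ ∞ (deriv D.R) := (contDiff_infty_iff_deriv.1 D.R_smooth).2

theorem hasDerivAt_deriv_R (r : ℝ) : HasDerivAt (deriv D.R) (deriv (deriv D.R) r) r :=
  (D.contDiff_deriv_R.differentiable (by simp) r).hasDerivAt

theorem h_pos (r : ℝ) : 0 < D.h r := one_pos.trans_le (D.h_ge_one r)

theorem deriv_R_of_lt {r : ℝ} (hr : r < 1) : deriv D.R r = 1 := by
  have h : D.R =ᶠ[nhds r] id := by
    filter_upwards [Iio_mem_nhds hr] with x hx using D.R_left x (le_of_lt hx)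
  rw [h.deriv_eq, deriv_id]

theorem deriv2_R_of_lt {r : ℝ} (hr : r < 1) : deriv (deriv D.R) r = 0 := by
  have h : deriv D.R =ᶠ[nhds r] fun _ => 1 := by
    filter_upwards [Iio_mem_nhds hr] with x hx using D.deriv_R_of_lt hx
  rw [h.deriv_eq, deriv_const]

theorem deriv_R_of_gt {r : ℝ} (hr : 5 < r) : deriv D.R r = 0 := by
  have h : D.R =ᶠ[nhds r] fun _ => 3 := by
    filter_upwards [Ioi_mem_nhds hr] with x hx using D.R_right x (le_of_lt hx)
  rw [h.deriv_eq, deriv_const]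

theorem deriv_R_antitone : Antitone (deriv D.R) :=
  antitone_of_deriv_nonpos (D.contDiff_deriv_R.differentiable (by simp)) D.R_deriv2_nonpos

/-- By concavity `R'` decreases, and it vanishes beyond 5. -/
theorem deriv_R_nonneg (r : ℝ) : 0 ≤ deriv D.R r := by
  rw [← D.deriv_R_of_gt (r := max r 6) (lt_max_of_lt_right (by norm_num))]
  exact D.deriv_R_antitone (le_max_left _ _)

theorem deriv_R_le_one (r : ℝ) : deriv D.R r ≤ 1 := by
  rw [← D.deriv_R_of_lt (r := min r 0) (min_lt_of_right_lt one_pos)]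
  exact D.deriv_R_antitone (min_le_left _ _)

theorem R_monotone : Monotone D.R :=
  monotone_of_deriv_nonneg (D.R_smooth.differentiable (by simp)) D.deriv_R_nonneg

theorem R_le_three (r : ℝ) : D.R r ≤ 3 := by
  rw [← D.R_right (max r 5) (le_max_right _ _)]
  exact D.R_monotone (le_max_left _ _)

theorem R_nonneg {r : ℝ} (hr : 0 ≤ r) : 0 ≤ D.R r := by
  rw [← D.R_left 0 zero_le_one]
  exact D.R_monotone hr

theorem deriv_h_of_lt {r : ℝ} (hr : r < -1) : deriv D.h r = Real.exp r := by
  have h : D.h =ᶠ[nhds r] fun x => 1 + Real.exp x := by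
    filter_upwards [Iio_mem_nhds hr] with x hx using D.h_left x (le_of_lt hx)
  rw [h.deriv_eq, ((Real.hasDerivAt_exp r).const_add 1).deriv]

theorem deriv2_h_of_lt {r : ℝ} (hr : r < -1) : deriv (deriv D.h) r = Real.exp r := by
  have h : deriv D.h =ᶠ[nhds r] Real.exp := by
    filter_upwards [Iio_mem_nhds hr] with x hx using D.deriv_h_of_lt hx
  rw [h.deriv_eq, Real.deriv_exp]

theorem deriv_h_of_gt {r : ℝ} (hr : 1 < r) : deriv D.h r = 2 * Real.exp r := by
  have h : D.h =ᶠ[nhds r] fun x => 2 * Real.exp x := by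
    filter_upwards [Ioi_mem_nhds hr] with x hx using D.h_right x (le_of_lt hx)
  rw [h.deriv_eq, ((Real.hasDerivAt_exp r).const_mul 2).deriv]

theorem deriv2_h_of_gt {r : ℝ} (hr : 1 < r) : deriv (deriv D.h) r = 2 * Real.exp r := by
  have h : deriv D.h =ᶠ[nhds r] fun x => 2 * Real.exp x := by
    filter_upwards [Ioi_mem_nhds hr] with x hx using D.deriv_h_of_gt hx
  rw [h.deriv_eq, ((Real.hasDerivAt_exp r).const_mul 2).deriv]

theorem continuous_deriv2_h : Continuous (deriv (deriv D.h)) :=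
  (contDiff_infty_iff_deriv.1 D.contDiff_deriv_h).2.continuous

theorem deriv2_h_of_ge {r : ℝ} (hr : 1 ≤ r) : deriv (deriv D.h) r = 2 * Real.exp r := by
  have h : closure (Ioi (1 : ℝ)) ⊆ {x | deriv (deriv D.h) x = 2 * Real.exp x} :=
    closure_minimal (fun y hy => D.deriv2_h_of_gt hy)
      (isClosed_eq D.continuous_deriv2_h (by fun_prop))
  rw [closure_Ioi] at h
  exact h hr

/-- The one place where `R'' ≥ -1/2` matters: `R''` is supported where `h'' = h = 2 e^r`, and there
the sum is at least `h / 2`. -/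
theorem deriv2_h_add_pos (r : ℝ) : 0 < deriv (deriv D.h) r + D.h r * deriv (deriv D.R) r := by
  rcases lt_or_ge r 1 with hr | hr
  · rw [D.deriv2_R_of_lt hr, mul_zero, add_zero]
    exact D.h_deriv2_pos r
  · rw [D.deriv2_h_of_ge hr, D.h_right r hr]
    nlinarith [D.R_deriv2_ge r, Real.exp_pos r]

/-- Outside `[-1, 1]` the explicit formulas give `h', h'' ≤ h`; on `[-1, 1]` compactness gives a
bound, which `h ≥ 1` turns into a multiple of `h`. -/
theorem exists_deriv_h_le : ∃ K : ℝ, 1 ≤ K ∧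
    ∀ r, deriv D.h r ≤ K * D.h r ∧ deriv (deriv D.h) r ≤ K * D.h r := by
  obtain ⟨K1, hK1⟩ := (isCompact_Icc (a := (-1 : ℝ)) (b := 1)).exists_bound_of_continuousOn
    D.contDiff_deriv_h.continuous.continuousOn
  obtain ⟨K2, hK2⟩ := (isCompact_Icc (a := (-1 : ℝ)) (b := 1)).exists_bound_of_continuousOn
    D.continuous_deriv2_h.continuousOn
  refine ⟨max (max K1 K2) 1, le_max_right _ _, fun r => ?_⟩
  have h1 := D.h_ge_one r
  have hK : D.h r ≤ max (max K1 K2) 1 * D.h r :=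
    le_mul_of_one_le_left (D.h_pos r).le (le_max_right _ _)
  have hK' : max (max K1 K2) 1 ≤ max (max K1 K2) 1 * D.h r :=
    le_mul_of_one_le_right (zero_le_one.trans (le_max_right _ _)) h1
  rcases lt_or_ge r (-1) with hr | hr
  · rw [D.deriv_h_of_lt hr, D.deriv2_h_of_lt hr]
    have := D.h_left r hr.le
    constructor <;> linarith
  rcases lt_or_ge 1 r with hr' | hr'
  · rw [D.deriv_h_of_gt hr', D.deriv2_h_of_gt hr']
    have := D.h_right r hr'.le
    constructor <;> linarith
  · have a1 := (le_abs_self _).trans (hK1 r ⟨hr, hr'⟩)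
    have a2 := (le_abs_self _).trans (hK2 r ⟨hr, hr'⟩)
    exact ⟨(a1.trans ((le_max_left _ _).trans (le_max_left _ _))).trans hK',
      (a2.trans ((le_max_right _ _).trans (le_max_left _ _))).trans hK'⟩

/-! The warping functions of the two flat factors and their partial derivatives. -/

variable (b : ℝ)

/-- The warping function `b h e^R` of the first flat factor. -/
def warp (r : ℝ) : ℝ := b * Real.exp (D.R r) * D.h r

/-- The derivative of `warp`. -/
def warp1 (r : ℝ) : ℝ := b * Real.exp (D.R r) * (deriv D.h r + D.h r * deriv D.R r)

/-- The second derivative of `warp`. -/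
def warp2 (r : ℝ) : ℝ := b * Real.exp (D.R r) * (deriv (deriv D.h) r
  + 2 * deriv D.h r * deriv D.R r + D.h r * deriv D.R r ^ 2 + D.h r * deriv (deriv D.R) r)

/-- The warping function `h F` of the second flat factor. -/
def fib (r t : ℝ) : ℝ := b * Real.exp (D.R r) * (D.h r * D.f (t - D.R r))

/-- The partial derivative of `fib` in `r`. -/
def fibR (r t : ℝ) : ℝ := b * Real.exp (D.R r) *
  (deriv D.h r * D.f (t - D.R r) + D.h r * deriv D.R r * D.tail (t - D.R r))

/-- The partial derivative of `fib` in `t`. -/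
def fibT (r t : ℝ) : ℝ := b * Real.exp (D.R r) * (D.h r * D.f1 (t - D.R r))

/-- The second partial derivative of `fib` in `r`. -/
def fibRR (r t : ℝ) : ℝ := b * Real.exp (D.R r) *
  (deriv (deriv D.h) r * D.f (t - D.R r) + 2 * deriv D.h r * deriv D.R r * D.tail (t - D.R r)
    + D.h r * deriv (deriv D.R) r * D.tail (t - D.R r)
    + D.h r * deriv D.R r ^ 2 * (D.tail (t - D.R r) + D.lam (t - D.R r)))

/-- The mixed second partial derivative of `fib`. -/
def fibRT (r t : ℝ) : ℝ := b * Real.exp (D.R r) *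
  (deriv D.h r * D.f1 (t - D.R r) - D.h r * deriv D.R r * D.lam (t - D.R r))

/-- The second partial derivative of `fib` in `t`. -/
def fibTT (r t : ℝ) : ℝ := b * Real.exp (D.R r) *
  (D.h r * (D.f1 (t - D.R r) + D.lam (t - D.R r)))

theorem hasDerivAt_mul_exp_R (r : ℝ) : HasDerivAt (fun r => b * Real.exp (D.R r))
    (b * (Real.exp (D.R r) * deriv D.R r)) r :=
  (D.hasDerivAt_R r).exp.const_mul b

theorem hasDerivAt_warp (r : ℝ) : HasDerivAt (D.warp b) (D.warp1 b r) r := by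
  refine ((D.hasDerivAt_mul_exp_R b r).fun_mul (D.hasDerivAt_h r)).congr_deriv ?_
  unfold warp1
  ring

theorem hasDerivAt_warp1 (r : ℝ) : HasDerivAt (D.warp1 b) (D.warp2 b r) r := by
  refine ((D.hasDerivAt_mul_exp_R b r).fun_mul ((D.hasDerivAt_deriv_h r).fun_add
    ((D.hasDerivAt_h r).fun_mul (D.hasDerivAt_deriv_R r)))).congr_deriv ?_
  unfold warp2
  ring

section Partial

open RiemVS

variable {G : Type*} [NormedAddCommGroup G] [NormedSpace ℝ G] (y : ℝ × ℝ × G)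

theorem hasFDerivAt_shift : HasFDerivAt (fun z : ℝ × ℝ × G => z.2.1 - D.R z.1)
    (baseForm (-deriv D.R y.1) 1) y := by
  have h1 : HasFDerivAt (fun z : ℝ × ℝ × G => z.2.1)
      (.fst ℝ ℝ G ∘L .snd ℝ ℝ (ℝ × G)) y := (hasFDerivAt_fst (p := y.2)).comp y hasFDerivAt_snd
  refine (h1.fun_sub (hasFDerivAt_comp_fst D.hasDerivAt_R y)).congr_fderiv ?_
  ext <;> simp

theorem hasFDerivAt_comp_shift {k k' : ℝ → ℝ} (hk : ∀ s, HasDerivAt k (k' s) s) :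
    HasFDerivAt (fun z : ℝ × ℝ × G => k (z.2.1 - D.R z.1))
      (baseForm (-deriv D.R y.1 * k' (y.2.1 - D.R y.1)) (k' (y.2.1 - D.R y.1))) y := by
  refine ((hk _).comp_hasFDerivAt y (D.hasFDerivAt_shift y)).congr_fderiv ?_
  ext <;> simp [mul_comm]

/-- Differentiating `e^R` and the shifted argument in `r` produces `R' (f - f')`, which is `R'
tail`. This substitution is what later isolates `λ` in the second derivatives. -/
theorem hasFDerivAt_fib : HasFDerivAt (fun z : ℝ × ℝ × G => D.fib b z.1 z.2.1)
    (baseForm (D.fibR b y.1 y.2.1) (D.fibT b y.1 y.2.1)) y := by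
  refine ((hasFDerivAt_comp_fst (D.hasDerivAt_mul_exp_R b) y).fun_mul
    ((hasFDerivAt_comp_fst D.hasDerivAt_h y).fun_mul
      (D.hasFDerivAt_comp_shift y D.hasDerivAt_f))).congr_fderiv ?_
  ext <;> simp [fibR, fibT, f1] <;> ring

theorem hasFDerivAt_fibR : HasFDerivAt (fun z : ℝ × ℝ × G => D.fibR b z.1 z.2.1)
    (baseForm (D.fibRR b y.1 y.2.1) (D.fibRT b y.1 y.2.1)) y := by
  refine ((hasFDerivAt_comp_fst (D.hasDerivAt_mul_exp_R b) y).fun_mul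
    (((hasFDerivAt_comp_fst D.hasDerivAt_deriv_h y).fun_mul
      (D.hasFDerivAt_comp_shift y D.hasDerivAt_f)).fun_add
      (((hasFDerivAt_comp_fst D.hasDerivAt_h y).fun_mul
        (hasFDerivAt_comp_fst D.hasDerivAt_deriv_R y)).fun_mul
          (D.hasFDerivAt_comp_shift y D.hasDerivAt_tail)))).congr_fderiv ?_
  ext <;> simp [fibRR, fibRT, f1] <;> ring

theorem hasFDerivAt_fibT : HasFDerivAt (fun z : ℝ × ℝ × G => D.fibT b z.1 z.2.1)
    (baseForm (D.fibRT b y.1 y.2.1) (D.fibTT b y.1 y.2.1)) y := by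
  refine ((hasFDerivAt_comp_fst (D.hasDerivAt_mul_exp_R b) y).fun_mul
    ((hasFDerivAt_comp_fst D.hasDerivAt_h y).fun_mul
      (D.hasFDerivAt_comp_shift y D.hasDerivAt_f1))).congr_fderiv ?_
  ext <;> simp [fibRT, fibTT] <;> ring

end Partial

theorem warp_pos {b : ℝ} (hb : 0 < b) (r : ℝ) : 0 < D.warp b r :=
  mul_pos (mul_pos hb (Real.exp_pos _)) (D.h_pos r)

theorem fib_pos {b : ℝ} (hb : 0 < b) (r t : ℝ) : 0 < D.fib b r t :=
  mul_pos (mul_pos hb (Real.exp_pos _))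
    (mul_pos (D.h_pos r) (one_pos.trans_le (D.f_ge_one _)))

theorem contDiff_warp : ContDiff ℝ ∞ (D.warp b) :=
  (contDiff_const.mul D.R_smooth.exp).mul D.h_smooth

theorem contDiff_fib : ContDiff ℝ ∞ fun x : ℝ × ℝ => D.fib b x.1 x.2 :=
  (contDiff_const.mul (D.R_smooth.comp contDiff_fst).exp).mul
    ((D.h_smooth.comp contDiff_fst).mul
      (D.f_smooth.comp (contDiff_snd.sub (D.R_smooth.comp contDiff_fst))))

end Profile

end WarpedModel

/-! ### Sign and size of the curvature of `g` -/

namespace WarpedModel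

theorem two_mul_abs_le_of_sq_le {x s t : ℝ} (hs : 0 ≤ s) (ht : 0 ≤ t) (h : x ^ 2 ≤ s * t) :
    2 * |x| ≤ s + t := by
  have : |2 * x| ≤ s + t := abs_le_of_sq_le_sq (by nlinarith [sq_nonneg (s - t)]) (by positivity)
  rwa [abs_mul, abs_two] at this

/-- The constant is determinant over trace of the matrix with entries `a, b, c`, a lower bound for
its least eigenvalue: `(a - m)(c - m) ≥ b²` reduces to `(ac - b²)² ≥ 0`. The data `s, y, t` form a
positive semidefinite matrix, not necessarily of rank one, because the flat factor may have several
directions. -/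
theorem exists_pos_mul_le_quadratic {a b c : ℝ} (ha : 0 < a) (hc : 0 < c) (h : b ^ 2 < a * c) :
    ∃ m : ℝ, 0 < m ∧ ∀ s t y : ℝ, 0 ≤ s → 0 ≤ t → y ^ 2 ≤ s * t →
      m * (s + t) ≤ a * s + 2 * b * y + c * t := by
  have hac : 0 < a + c := by positivity
  refine ⟨(a * c - b ^ 2) / (a + c), div_pos (by linarith) hac, fun s t y hs ht hy => ?_⟩
  set m := (a * c - b ^ 2) / (a + c) with hm
  have h1 : a - m = (a ^ 2 + b ^ 2) / (a + c) := by rw [hm]; field_simp; ring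
  have h2 : c - m = (c ^ 2 + b ^ 2) / (a + c) := by rw [hm]; field_simp; ring
  have h3 : 0 ≤ a - m := by rw [h1]; positivity
  have h4 : 0 ≤ c - m := by rw [h2]; positivity
  have h5 : b ^ 2 ≤ (a - m) * (c - m) := by
    rw [h1, h2, div_mul_div_comm, le_div_iff₀ (by positivity)]
    nlinarith [sq_nonneg (a * c - b ^ 2)]
  have h6 : (b * y) ^ 2 ≤ ((a - m) * s) * ((c - m) * t) := by
    calc (b * y) ^ 2 = b ^ 2 * y ^ 2 := by ring
      _ ≤ ((a - m) * (c - m)) * (s * t) := by gcongr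
      _ = _ := by ring
  have h7 := two_mul_abs_le_of_sq_le (mul_nonneg h3 hs) (mul_nonneg h4 ht) h6
  nlinarith [neg_abs_le (b * y)]

theorem quadratic_le {a b c M M' : ℝ} (ha : a ≤ M) (hc : c ≤ M) (hb : |b| ≤ M') {s t y : ℝ}
    (hs : 0 ≤ s) (ht : 0 ≤ t) (h : y ^ 2 ≤ s * t) :
    a * s + 2 * b * y + c * t ≤ (M + M') * (s + t) := by
  have h1 := two_mul_abs_le_of_sq_le hs ht h
  have h2 : b * y ≤ M' * |y| := by
    calc b * y ≤ |b * y| := le_abs_self _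
      _ = |b| * |y| := abs_mul _ _
      _ ≤ M' * |y| := by gcongr
  have hM' : 0 ≤ M' := (abs_nonneg b).trans hb
  nlinarith [mul_le_mul_of_nonneg_right ha hs, mul_le_mul_of_nonneg_right hc ht,
    mul_le_mul_of_nonneg_left h1 hM']

/-- This is the squared length of `x v - y u`, written through the Gram entries `a, b, c` of `u, v`.
-/
theorem gram_combination_nonneg {a b c : ℝ} (ha : 0 ≤ a) (hc : 0 ≤ c) (h : b ^ 2 ≤ a * c)
    (x y : ℝ) : 0 ≤ x ^ 2 * c - 2 * x * y * b + y ^ 2 * a := by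
  have h1 : (x * y * b) ^ 2 ≤ (x ^ 2 * c) * (y ^ 2 * a) := by
    calc (x * y * b) ^ 2 = x ^ 2 * y ^ 2 * b ^ 2 := by ring
      _ ≤ x ^ 2 * y ^ 2 * (a * c) := by gcongr
      _ = _ := by ring
  have := two_mul_abs_le_of_sq_le (mul_nonneg (sq_nonneg x) hc) (mul_nonneg (sq_nonneg y) ha) h1
  nlinarith [le_abs_self (x * y * b)]

theorem mixed_gram_nonneg {a b c a' b' c' : ℝ} (ha : 0 ≤ a) (hc : 0 ≤ c) (h : b ^ 2 ≤ a * c)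
    (ha' : 0 ≤ a') (hc' : 0 ≤ c') (h' : b' ^ 2 ≤ a' * c') :
    0 ≤ a * c' + c * a' - 2 * b * b' := by
  have h1 : (b * b') ^ 2 ≤ (a * c') * (c * a') := by
    calc (b * b') ^ 2 = b ^ 2 * b' ^ 2 := by ring
      _ ≤ (a * c) * (a' * c') := by gcongr
      _ = _ := by ring
  have := two_mul_abs_le_of_sq_le (mul_nonneg ha hc') (mul_nonneg hc ha') h1
  nlinarith [le_abs_self (b * b')]

/-- Dictionary: `κ = h''/h`, `η = h'/h`, `ρ = R'`, `σ = R''`, `Λ = tail`, `μ = λ`, `φ = f'/h²`, `φ1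
= f'/h`, `ν = λ/h²`, `ν1 = λ/h`. For the determinant of the 2×2 block, write the diagonal numerators
as `A + ρ²μ` and `C + ν`. The off-diagonal square is `ρ²μν`, so the surplus is at least `A C > 0`.
Positivity of `A` uses `σΛ ≥ σf`, valid since `σ ≤ 0` and `Λ ≤ 1 ≤ f`. -/
theorem curvature_coeff_pos {κ η ρ σ f Λ μ φ φ1 ν ν1 : ℝ} (hη : 0 < η) (hρ : 0 ≤ ρ)
    (hσ : σ ≤ 0) (hκσ : 0 < κ + σ) (hf : 1 ≤ f) (hΛ0 : 0 ≤ Λ) (hΛ1 : Λ ≤ 1) (hμ : 0 ≤ μ)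
    (hφ : 0 ≤ φ) (hν : 0 ≤ ν) (hsq : ν1 ^ 2 = μ * ν) :
    0 < κ + 2 * η * ρ + ρ ^ 2 + σ ∧ 0 < η * (η + ρ) ∧ 0 < (η + ρ) ^ 2 ∧
      0 < ((η * f + ρ * Λ) / f) ^ 2 + (φ1 / f) ^ 2 ∧ 0 < (η + ρ) * ((η * f + ρ * Λ) / f) ∧
      0 < (κ * f + 2 * η * ρ * Λ + σ * Λ + ρ ^ 2 * Λ + ρ ^ 2 * μ) / f ∧
      0 < (φ + η * (η * f + ρ * Λ) + ν) / f ∧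
      (-(ρ * ν1) / f) ^ 2 <
        (κ * f + 2 * η * ρ * Λ + σ * Λ + ρ ^ 2 * Λ + ρ ^ 2 * μ) / f *
          ((φ + η * (η * f + ρ * Λ) + ν) / f) := by
  have hf0 : 0 < f := by linarith
  have hA : 0 < κ * f + 2 * η * ρ * Λ + σ * Λ + ρ ^ 2 * Λ := by
    have h1 : σ * f ≤ σ * Λ := mul_le_mul_of_nonpos_left (by linarith) hσ
    have h2 : 0 < (κ + σ) * f := by positivity
    have h3 : 0 ≤ 2 * η * ρ * Λ + ρ ^ 2 * Λ := by positivity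
    linarith
  have hC : 0 < φ + η * (η * f + ρ * Λ) := by positivity
  have h1 : 0 ≤ ρ ^ 2 * μ := by positivity
  refine ⟨?_, by positivity, by positivity, by positivity, by positivity, by positivity,
    by positivity, ?_⟩
  · have : 0 ≤ 2 * η * ρ + ρ ^ 2 := by positivity
    linarith
  · rw [div_mul_div_comm, div_pow, ← sq, div_lt_div_iff_of_pos_right (by positivity), neg_sq,
      mul_pow, hsq]
    linarith [mul_pos hA hC, mul_nonneg hA.le hν, mul_nonneg h1 hC.le]

/-- `K + 1` bounds the logarithmic `r`-derivatives of both warping functions, the summand 1 absorbs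
the leftover terms in `f'` and `R'²`, and one `M` absorbs `λ`. The block entries are kept one `M`
smaller, because `quadratic_le` adds the off-diagonal bound `M` to the diagonal one. -/
theorem curvature_coeff_le {κ η ρ σ f Λ μ φ φ1 ν ν1 K M : ℝ} (hK : 1 ≤ K) (hη0 : 0 ≤ η)
    (hη : η ≤ K) (hκ : κ ≤ K) (hρ0 : 0 ≤ ρ) (hρ1 : ρ ≤ 1) (hσ : σ ≤ 0)
    (hf : 1 ≤ f) (hΛ0 : 0 ≤ Λ) (hΛ1 : Λ ≤ 1) (hμM : μ ≤ M) (hφ : φ ≤ f) (hν : ν ≤ M)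
    (hν10 : 0 ≤ ν1) (hν1 : ν1 ≤ M) (hφ10 : 0 ≤ φ1) (hφ1 : φ1 ≤ f) (hμ0 : 0 ≤ μ) :
    κ ≤ (K + 1) ^ 2 + 1 + M + M ∧ κ + 2 * η * ρ + ρ ^ 2 + σ ≤ (K + 1) ^ 2 + 1 + M + M ∧
      η * (η + ρ) ≤ (K + 1) ^ 2 + 1 + M + M ∧ (η + ρ) ^ 2 ≤ (K + 1) ^ 2 + 1 + M + M ∧
      ((η * f + ρ * Λ) / f) ^ 2 + (φ1 / f) ^ 2 ≤ (K + 1) ^ 2 + 1 + M + M ∧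
      (η + ρ) * ((η * f + ρ * Λ) / f) ≤ (K + 1) ^ 2 + 1 + M + M ∧
      (κ * f + 2 * η * ρ * Λ + σ * Λ + ρ ^ 2 * Λ + ρ ^ 2 * μ) / f ≤ (K + 1) ^ 2 + 1 + M ∧
      (φ + η * (η * f + ρ * Λ) + ν) / f ≤ (K + 1) ^ 2 + 1 + M ∧ |-(ρ * ν1) / f| ≤ M := by
  have hf0 : 0 < f := by linarith
  have K0 : 0 ≤ K := by linarith
  have M0 : 0 ≤ M := hμ0.trans hμM
  have KK : K ≤ K ^ 2 := by rw [sq]; exact le_mul_of_one_le_left K0 hK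
  have ρρ : ρ ^ 2 ≤ 1 := pow_le_one₀ hρ0 hρ1
  have ηρ : η * ρ ≤ K := (mul_le_mul hη hρ1 hρ0 K0).trans_eq (mul_one K)
  have hMf : M ≤ M * f := le_mul_of_one_le_right M0 hf
  have hρμ : ρ ^ 2 * μ ≤ M := (mul_le_mul ρρ hμM hμ0 zero_le_one).trans_eq (one_mul M)
  have gn : η * f + ρ * Λ ≤ (K + 1) * f := by
    have h1 : η * f ≤ K * f := by gcongr
    have h2 : ρ * Λ ≤ 1 := mul_le_one₀ hρ1 hΛ0 hΛ1
    linarith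
  have gq : (η * f + ρ * Λ) / f ≤ K + 1 := by rwa [div_le_iff₀ hf0]
  have gq0 : 0 ≤ (η * f + ρ * Λ) / f := by positivity
  refine ⟨by linarith, by linarith, ?_, ?_, ?_, ?_, ?_, ?_, ?_⟩
  · have : η * (η + ρ) ≤ K * (K + 1) := by gcongr
    linarith
  · have : (η + ρ) ^ 2 ≤ (K + 1) ^ 2 := by gcongr
    linarith
  · have h1 : ((η * f + ρ * Λ) / f) ^ 2 ≤ (K + 1) ^ 2 := by gcongr
    have h2 : (φ1 / f) ^ 2 ≤ 1 := pow_le_one₀ (by positivity) (by rwa [div_le_one hf0])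
    linarith
  · have : (η + ρ) * ((η * f + ρ * Λ) / f) ≤ (K + 1) * (K + 1) := by gcongr
    linarith
  · rw [div_le_iff₀ hf0]
    have h1 : κ * f ≤ K * f := by gcongr
    have h2 : η * ρ * Λ ≤ K * f := (mul_le_mul ηρ hΛ1 hΛ0 K0).trans (by gcongr)
    have h3 : σ * Λ ≤ 0 := mul_nonpos_of_nonpos_of_nonneg hσ hΛ0
    have h4 : ρ ^ 2 * Λ ≤ 1 := mul_le_one₀ ρρ hΛ0 hΛ1
    have h5 : K * f ≤ K ^ 2 * f := by gcongr
    linarith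
  · rw [div_le_iff₀ hf0]
    have h2 : η * (η * f + ρ * Λ) ≤ K * ((K + 1) * f) := by gcongr
    have h3 : 0 ≤ K * f := by positivity
    linarith
  · rw [neg_div, abs_neg, abs_of_nonneg (by positivity), div_le_iff₀ hf0]
    exact ((mul_le_mul hρ1 hν1 hν10 zero_le_one).trans_eq (one_mul M)).trans hMf

theorem inner_sq_le {F : Type*} [NormedAddCommGroup F] [InnerProductSpace ℝ F] (x y : F) :
    inner ℝ x y ^ 2 ≤ inner ℝ x x * inner ℝ y y := by
  rw [sq]; exact real_inner_mul_inner_self_le x y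

namespace Profile

open RiemVS

variable (D : Profile) {V W : Type*} [NormedAddCommGroup V] [InnerProductSpace ℝ V]
  [NormedAddCommGroup W] [InnerProductSpace ℝ W]

set_option maxSynthPendingDepth 5

/-- The coefficient field of the metric `g`. -/
def metricForm (b : ℝ) : (ℝ × ℝ × V × W) → (ℝ × ℝ × V × W) →L[ℝ] (ℝ × ℝ × V × W) →L[ℝ] ℝ :=
  fourBlock D.h (D.warp b) (D.fib b)

theorem contDiff_metricForm (b : ℝ) : ContDiff ℝ ∞ (D.metricForm (V := V) (W := W) b) :=
  contDiff_fourBlock D.h_smooth (D.contDiff_warp b) (D.contDiff_fib b)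

variable [FiniteDimensional ℝ V] [FiniteDimensional ℝ W]

/-- The curvature of `g` in an orthonormal frame adapted to the warped product structure. -/
theorem curvature_metricForm {b : ℝ} (hb : 0 < b) (y u v : ℝ × ℝ × V × W)
    {H H1 H2 ρ σ f f1 Λ μ : ℝ} (eH : D.h y.1 = H) (eH1 : deriv D.h y.1 = H1)
    (eH2 : deriv (deriv D.h) y.1 = H2) (eρ : deriv D.R y.1 = ρ)
    (eσ : deriv (deriv D.R) y.1 = σ) (ef : D.f (y.2.1 - D.R y.1) = f)
    (ef1 : D.f1 (y.2.1 - D.R y.1) = f1) (eΛ : D.tail (y.2.1 - D.R y.1) = Λ)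
    (eμ : D.lam (y.2.1 - D.R y.1) = μ) :
    ∃ w x₁ x₂ y₁ y₂ y₁₂ a₃ a₄ a₃₄ : ℝ, 0 ≤ w ∧ 0 ≤ x₁ ∧ 0 ≤ x₂ ∧ 0 ≤ y₁ ∧ 0 ≤ y₂ ∧
      y₁₂ ^ 2 ≤ y₁ * y₂ ∧ 0 ≤ a₃ ∧ 0 ≤ a₄ ∧ 0 ≤ a₃₄ ∧
      D.metricForm b y u u * D.metricForm b y v v - D.metricForm b y u v ^ 2 =
        w + x₁ + x₂ + (y₁ + y₂) + a₃ + a₄ + a₃₄ ∧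
      D.metricForm b y (curvature (D.metricForm b) y u v v) u =
        -(H2 / H * w + (H2 / H + 2 * (H1 / H) * ρ + ρ ^ 2 + σ) * x₁ + H1 / H * (H1 / H + ρ) * x₂
          + ((H2 / H * f + 2 * (H1 / H) * ρ * Λ + σ * Λ + ρ ^ 2 * Λ + ρ ^ 2 * μ) / f * y₁
            + 2 * (-(ρ * μ / H) / f) * y₁₂
            + (f1 / H ^ 2 + H1 / H * (H1 / H * f + ρ * Λ) + μ / H ^ 2) / f * y₂)
          + (H1 / H + ρ) ^ 2 * a₃
          + (((H1 / H * f + ρ * Λ) / f) ^ 2 + (f1 / H / f) ^ 2) * a₄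
          + (H1 / H + ρ) * ((H1 / H * f + ρ * Λ) / f) * a₃₄) := by
  have hH : H ≠ 0 := by rw [← eH]; exact (D.h_pos _).ne'
  have hf : f ≠ 0 := by rw [← ef]; exact (one_pos.trans_le (D.f_ge_one _)).ne'
  obtain ⟨e, he⟩ : ∃ e, b * Real.exp (D.R y.1) = e := ⟨_, rfl⟩
  have he0 : e ≠ 0 := by rw [← he]; positivity
  have gp := inner_sq_le u.2.2.1 v.2.2.1
  have gp' := inner_sq_le u.2.2.2 v.2.2.2
  have ha := real_inner_self_nonneg (x := u.2.2.1)
  have hc := real_inner_self_nonneg (x := v.2.2.1)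
  have ha' := real_inner_self_nonneg (x := u.2.2.2)
  have hc' := real_inner_self_nonneg (x := v.2.2.2)
  have key := form_curvature_fourBlock D.h_pos (D.warp_pos hb) (D.fib_pos hb)
    (contDiff_fourBlock D.h_smooth (D.contDiff_warp b) (D.contDiff_fib b))
    D.hasDerivAt_h D.hasDerivAt_deriv_h (D.hasDerivAt_warp b) (D.hasDerivAt_warp1 b)
    (D.hasFDerivAt_fib b) (D.hasFDerivAt_fibR b) (D.hasFDerivAt_fibT b) y u v
    (H := H) (H1 := H1) (H2 := H2) (P := e * H) (P1 := e * (H1 + H * ρ))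
    (P2 := e * (H2 + 2 * H1 * ρ + H * ρ ^ 2 + H * σ))
    (Q := e * (H * f)) (Qr := e * (H1 * f + H * ρ * Λ)) (Qt := e * (H * f1))
    (Qrr := e * (H2 * f + 2 * H1 * ρ * Λ + H * σ * Λ + H * ρ ^ 2 * (Λ + μ)))
    (Qrt := e * (H1 * f1 - H * ρ * μ)) (Qtt := e * (H * (f1 + μ)))
    eH eH1 eH2 (by rw [warp, he, eH]) (by rw [warp1, he, eH, eH1, eρ])
    (by rw [warp2, he, eH, eH1, eH2, eρ, eσ]) (by rw [fib, he, eH, ef])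
    (by rw [fibR, he, eH, eH1, ef, eρ, eΛ]) (by rw [fibT, he, eH, ef1])
    (by rw [fibRR, he, eH, eH1, eH2, ef, eρ, eσ, eΛ, eμ]) (by rw [fibRT, he, eH, eH1, ef1, eρ, eμ])
    (by rw [fibTT, he, eH, ef1, eμ]) rfl rfl rfl rfl rfl rfl
  have area : D.metricForm b y u u * D.metricForm b y v v - D.metricForm b y u v ^ 2 =
    (u.1 * u.1 + H ^ 2 * (u.2.1 * u.2.1) + (e * H) ^ 2 * inner ℝ u.2.2.1 u.2.2.1
      + (e * (H * f)) ^ 2 * inner ℝ u.2.2.2 u.2.2.2) *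
    (v.1 * v.1 + H ^ 2 * (v.2.1 * v.2.1) + (e * H) ^ 2 * inner ℝ v.2.2.1 v.2.2.1
      + (e * (H * f)) ^ 2 * inner ℝ v.2.2.2 v.2.2.2) -
    (u.1 * v.1 + H ^ 2 * (u.2.1 * v.2.1) + (e * H) ^ 2 * inner ℝ u.2.2.1 v.2.2.1
      + (e * (H * f)) ^ 2 * inner ℝ u.2.2.2 v.2.2.2) ^ 2 := by
    simp only [metricForm, fourBlock_apply, warp, fib, he, eH, ef]
  rw [area]
  change D.metricForm b y (curvature (D.metricForm b) y u v v) u = _ at key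
  rw [key]
  -- From here on only algebra in the components and Gram entries of `u` and `v` remains.
  clear key area he eH eH1 eH2 eρ eσ ef ef1 eΛ eμ
  generalize (inner ℝ u.2.2.1 v.2.2.1 : ℝ) = β at *
  generalize (inner ℝ u.2.2.1 u.2.2.1 : ℝ) = α at *
  generalize (inner ℝ v.2.2.1 v.2.2.1 : ℝ) = γ at *
  generalize (inner ℝ u.2.2.2 v.2.2.2 : ℝ) = β' at *
  generalize (inner ℝ u.2.2.2 u.2.2.2 : ℝ) = α' at *
  generalize (inner ℝ v.2.2.2 v.2.2.2 : ℝ) = γ' at *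
  generalize u.1 = u₁ at *
  generalize u.2.1 = u₂ at *
  generalize v.1 = v₁ at *
  generalize v.2.1 = v₂ at *
  -- The witnesses are the squared components of `u ∧ v` along `r∧t`, `r∧ρ`, `t∧ρ`, `r∧τ`, `t∧τ`,
  -- then the inner product of the last two, then `ρ∧ρ`, `τ∧τ` and `ρ∧τ`, in the frame normalized by
  -- `H`, `e * H` and `e * H * f`.
  refine ⟨H ^ 2 * (u₁ * v₂ - v₁ * u₂) ^ 2,
    (e * H) ^ 2 * (u₁ ^ 2 * γ - 2 * u₁ * v₁ * β + v₁ ^ 2 * α),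
    (e * H ^ 2) ^ 2 * (u₂ ^ 2 * γ - 2 * u₂ * v₂ * β + v₂ ^ 2 * α),
    (e * (H * f)) ^ 2 * (u₁ ^ 2 * γ' - 2 * u₁ * v₁ * β' + v₁ ^ 2 * α'),
    (e * (H ^ 2 * f)) ^ 2 * (u₂ ^ 2 * γ' - 2 * u₂ * v₂ * β' + v₂ ^ 2 * α'),
    e ^ 2 * H ^ 3 * f ^ 2 * (u₁ * u₂ * γ' - (u₁ * v₂ + v₁ * u₂) * β' + v₁ * v₂ * α'),
    (e * H) ^ 4 * (α * γ - β ^ 2), (e * (H * f)) ^ 4 * (α' * γ' - β' ^ 2),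
    (e * H * (e * (H * f))) ^ 2 * (α * γ' + γ * α' - 2 * β * β'), by positivity,
    mul_nonneg (sq_nonneg _) (gram_combination_nonneg ha hc gp _ _),
    mul_nonneg (sq_nonneg _) (gram_combination_nonneg ha hc gp _ _),
    mul_nonneg (sq_nonneg _) (gram_combination_nonneg ha' hc' gp' _ _),
    mul_nonneg (sq_nonneg _) (gram_combination_nonneg ha' hc' gp' _ _), ?_,
    mul_nonneg (by positivity) (sub_nonneg.2 gp), mul_nonneg (by positivity) (sub_nonneg.2 gp'),
    mul_nonneg (by positivity) (mixed_gram_nonneg ha hc gp ha' hc' gp'), by ring, ?_⟩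
  -- The `r∧τ` and `t∧τ` components are linear combinations of the `τ`-parts of `u, v`, so their
  -- Gram determinant is that of these parts times a squared determinant.
  · have : 0 ≤ (e ^ 2 * H ^ 3 * f ^ 2 * (u₁ * v₂ - v₁ * u₂)) ^ 2 * (α' * γ' - β' ^ 2) :=
      mul_nonneg (sq_nonneg _) (sub_nonneg.2 gp')
    linear_combination this
  · field_simp
    ring

/-- A two-sided bound for the curvature of `g` at each point. -/
theorem exists_bounds_metricForm {b : ℝ} (hb : 0 < b) {K M : ℝ} (hK : 1 ≤ K)
    (hKh : ∀ r, deriv D.h r ≤ K * D.h r ∧ deriv (deriv D.h) r ≤ K * D.h r)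
    (hM : ∀ s, D.lam s ≤ M) (y : ℝ × ℝ × V × W) :
    ∃ m : ℝ, 0 < m ∧ ∀ u v : ℝ × ℝ × V × W,
      -(((K + 1) ^ 2 + 1 + M + M) *
          (D.metricForm b y u u * D.metricForm b y v v - D.metricForm b y u v ^ 2)) ≤
        D.metricForm b y (curvature (D.metricForm b) y u v v) u ∧
      D.metricForm b y (curvature (D.metricForm b) y u v v) u ≤
        -(m * (D.metricForm b y u u * D.metricForm b y v v - D.metricForm b y u v ^ 2)) := by
  obtain ⟨H, eH⟩ : ∃ x, D.h y.1 = x := ⟨_, rfl⟩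
  obtain ⟨H1, eH1⟩ : ∃ x, deriv D.h y.1 = x := ⟨_, rfl⟩
  obtain ⟨H2, eH2⟩ : ∃ x, deriv (deriv D.h) y.1 = x := ⟨_, rfl⟩
  obtain ⟨ρ, eρ⟩ : ∃ x, deriv D.R y.1 = x := ⟨_, rfl⟩
  obtain ⟨σ, eσ⟩ : ∃ x, deriv (deriv D.R) y.1 = x := ⟨_, rfl⟩
  obtain ⟨f, ef⟩ : ∃ x, D.f (y.2.1 - D.R y.1) = x := ⟨_, rfl⟩
  obtain ⟨f1, ef1⟩ : ∃ x, D.f1 (y.2.1 - D.R y.1) = x := ⟨_, rfl⟩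
  obtain ⟨Λ, eΛ⟩ : ∃ x, D.tail (y.2.1 - D.R y.1) = x := ⟨_, rfl⟩
  obtain ⟨μ, eμ⟩ : ∃ x, D.lam (y.2.1 - D.R y.1) = x := ⟨_, rfl⟩
  have H_ge : 1 ≤ H := eH ▸ D.h_ge_one _
  have H_pos : 0 < H := by linarith
  have H1_pos : 0 < H1 := eH1 ▸ D.h_deriv_pos _
  have H2_pos : 0 < H2 := eH2 ▸ D.h_deriv2_pos _
  have ρ0 : 0 ≤ ρ := eρ ▸ D.deriv_R_nonneg _
  have ρ1 : ρ ≤ 1 := eρ ▸ D.deriv_R_le_one _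
  have σ0 : σ ≤ 0 := eσ ▸ D.R_deriv2_nonpos _
  have κσ : 0 < H2 + H * σ := eH ▸ eH2 ▸ eσ ▸ D.deriv2_h_add_pos _
  have f_ge : 1 ≤ f := ef ▸ D.f_ge_one _
  have f_pos : 0 < f := by linarith
  have f10 : 0 ≤ f1 := ef1 ▸ D.f1_nonneg _
  have Λ0 : 0 ≤ Λ := eΛ ▸ D.tail_nonneg _
  have Λ1 : Λ ≤ 1 := eΛ ▸ D.tail_le_one _
  have f1_eq : f1 = f - Λ := by rw [← ef1, ← ef, ← eΛ, Profile.f1]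
  have μ0 : 0 ≤ μ := eμ ▸ D.lam_nonneg _
  have μM : μ ≤ M := eμ ▸ hM _
  have η_le : H1 / H ≤ K := by
    rw [div_le_iff₀ H_pos, ← eH1, ← eH]; exact (hKh _).1
  have κ_le : H2 / H ≤ K := by
    rw [div_le_iff₀ H_pos, ← eH2, ← eH]; exact (hKh _).2
  have κσ' : 0 < H2 / H + σ := by
    have : H2 / H + σ = (H2 + H * σ) / H := by field_simp
    rw [this]; positivity
  have form := fun u v => D.curvature_metricForm hb y u v eH eH1 eH2 eρ eσ ef ef1 eΛ eμ
  clear eH eH1 eH2 eρ eσ ef ef1 eΛ eμ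
  have η_pos : 0 < H1 / H := by positivity
  have κ_pos : 0 < H2 / H := by positivity
  have hμH : μ / H ^ 2 ≤ μ := div_le_self μ0 (one_le_pow₀ H_ge)
  have hfH : f1 / H ^ 2 ≤ f1 := div_le_self f10 (one_le_pow₀ H_ge)
  have hμH1 : μ / H ≤ μ := div_le_self μ0 H_ge
  have hfH1 : f1 / H ≤ f1 := div_le_self f10 H_ge
  have hμH0 : 0 ≤ μ / H ^ 2 := by positivity
  have hfH0 : 0 ≤ f1 / H ^ 2 := by positivity
  have hsq : (μ / H) ^ 2 = μ * (μ / H ^ 2) := by field_simp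
  have hμH10 : 0 ≤ μ / H := by positivity
  have hfH10 : 0 ≤ f1 / H := by positivity
  have hM0 : 0 ≤ M := μ0.trans μM
  have eμ1 : ρ * μ / H = ρ * (μ / H) := mul_div_assoc _ _ _
  generalize hη : H1 / H = η at *
  generalize hκ : H2 / H = κ at *
  generalize hν : μ / H ^ 2 = ν at *
  generalize hν1 : μ / H = ν1 at *
  generalize hφ : f1 / H ^ 2 = φ at *
  generalize hφ1 : f1 / H = φ1 at *
  clear hη hκ hν hν1 hφ hφ1 hKh hM κσ H1_pos H2_pos
  obtain ⟨c1, c2, c3, c4, c5, c6, c7, hquad⟩ := curvature_coeff_pos η_pos ρ0 σ0 κσ' f_ge Λ0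
    Λ1 μ0 hfH0 hμH0 hsq (φ1 := φ1)
  obtain ⟨b0, b1, b2, b3, b4, b5, b6, b7, b8⟩ := curvature_coeff_le hK η_pos.le η_le κ_le
    ρ0 ρ1 σ0 f_ge Λ0 Λ1 μM (hfH.trans (by linarith)) (hμH.trans μM) hμH10 (hμH1.trans μM) hfH10
    (hfH1.trans (by linarith)) μ0
  obtain ⟨m, hm, hq⟩ := exists_pos_mul_le_quadratic c6 c7 hquad
  -- The least of the scalar coefficients and of the block bound `m`; it depends on the point.
  refine ⟨min (min (min κ (κ + 2 * η * ρ + ρ ^ 2 + σ)) (min (η * (η + ρ)) m))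
    (min (min ((η + ρ) ^ 2) (((η * f + ρ * Λ) / f) ^ 2 + (φ1 / f) ^ 2))
      ((η + ρ) * ((η * f + ρ * Λ) / f))), by simp only [lt_min_iff]; tauto, fun u v => ?_⟩
  obtain ⟨w, x₁, x₂, y₁, y₂, y₁₂, a₃, a₄, a₃₄, w0, x10, x20, y10, y20, yy, a30, a40, a340,
    hS, hN⟩ := form u v
  rw [hS, hN, eμ1]
  constructor
  · have q := quadratic_le b6 b7 b8 y10 y20 yy
    have := mul_le_mul_of_nonneg_right b0 w0
    have := mul_le_mul_of_nonneg_right b1 x10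
    have := mul_le_mul_of_nonneg_right b2 x20
    have := mul_le_mul_of_nonneg_right b3 a30
    have := mul_le_mul_of_nonneg_right b4 a40
    have := mul_le_mul_of_nonneg_right b5 a340
    linarith
  · have q := hq y₁ y₂ y₁₂ y10 y20 yy
    set n := min (min (min κ (κ + 2 * η * ρ + ρ ^ 2 + σ)) (min (η * (η + ρ)) m))
      (min (min ((η + ρ) ^ 2) (((η * f + ρ * Λ) / f) ^ 2 + (φ1 / f) ^ 2))
        ((η + ρ) * ((η * f + ρ * Λ) / f))) with hn
    have n0 : n ≤ κ := by simp [hn]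
    have n1 : n ≤ κ + 2 * η * ρ + ρ ^ 2 + σ := by simp [hn]
    have n2 : n ≤ η * (η + ρ) := by simp [hn]
    have nm : n ≤ m := by simp [hn]
    have n3 : n ≤ (η + ρ) ^ 2 := by simp [hn]
    have n4 : n ≤ ((η * f + ρ * Λ) / f) ^ 2 + (φ1 / f) ^ 2 := by simp [hn]
    have n5 : n ≤ (η + ρ) * ((η * f + ρ * Λ) / f) := by simp [hn]
    have := mul_le_mul_of_nonneg_right n0 w0
    have := mul_le_mul_of_nonneg_right n1 x10
    have := mul_le_mul_of_nonneg_right n2 x20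
    have := mul_le_mul_of_nonneg_right nm (add_nonneg y10 y20)
    have := mul_le_mul_of_nonneg_right n3 a30
    have := mul_le_mul_of_nonneg_right n4 a40
    have := mul_le_mul_of_nonneg_right n5 a340
    linarith

end Profile

end WarpedModel

/-! ### Lattice quotients and their volume -/

namespace WarpedModel

/-- A lattice has a bounded measurable strict fundamental domain. -/
theorem exists_fundamental_set {E : Type*} [NormedAddCommGroup E] [NormedSpace ℝ E]
    [FiniteDimensional ℝ E] [MeasurableSpace E] [BorelSpace E] (L : Submodule ℤ E)
    [DiscreteTopology L] [IsZLattice ℝ L] :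
    ∃ S : Set E, MeasurableSet S ∧ Bornology.IsBounded S ∧ ∀ x : E, ∃! v : L, x + (v : E) ∈ S := by
  let b := (Module.Free.chooseBasis ℤ L).ofZLatticeBasis ℝ
  have hb : Submodule.span ℤ (Set.range b) = L := Module.Basis.ofZLatticeBasis_span ℝ L _
  refine ⟨ZSpan.fundamentalDomain b, ZSpan.fundamentalDomain_measurableSet b,
    ZSpan.fundamentalDomain_isBounded b, fun x => ?_⟩
  obtain ⟨v, hv, huniq⟩ := ZSpan.exist_unique_vadd_mem_fundamentalDomain b x
  refine ⟨⟨v, hb.le v.2⟩, ?_, fun w hw => ?_⟩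
  · have : (v : E) + x ∈ ZSpan.fundamentalDomain b := hv
    rwa [add_comm] at this
  · have h := huniq ⟨w, hb.ge w.2⟩ (show (w : E) + x ∈ _ by rw [add_comm]; exact hw)
    have h' : (w : E) = v := congrArg Subtype.val h
    exact Subtype.ext h'

variable {l m : ℕ}

/-- Translation in the two flat factors. -/
def translate (a : EuclideanSpace ℝ (Fin l)) (a' : EuclideanSpace ℝ (Fin m)) (y : Y l m) : Y l m :=
  y + (0, 0, a, a')

theorem measurable_translate (a : EuclideanSpace ℝ (Fin l)) (a' : EuclideanSpace ℝ (Fin m)) :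
    Measurable (translate a a') := measurable_add_const _

theorem translate_translate_neg (a : EuclideanSpace ℝ (Fin l)) (a' : EuclideanSpace ℝ (Fin m))
    (y : Y l m) : translate a a' (translate (-a) (-a') y) = y := by
  simp [translate, add_assoc]

section Quotient

variable (L : Submodule ℤ (EuclideanSpace ℝ (Fin l))) (L' : Submodule ℤ (EuclideanSpace ℝ (Fin m)))

theorem proj_eq_proj_iff (y z : Y l m) :
    proj L L' y = proj L L' z ↔ ∃ (a : L) (a' : L'), z = translate a a' y := by
  simp only [proj, Prod.mk.injEq, QuotientAddGroup.eq, translate]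
  constructor
  · rintro ⟨h1, h2, h3, h4⟩
    refine ⟨⟨_, h3⟩, ⟨_, h4⟩, ?_⟩
    ext <;> simp [h1, h2]
  · rintro ⟨a, a', rfl⟩
    refine ⟨by simp, by simp, ?_, ?_⟩
    · simp
    · simp

theorem continuous_proj : Continuous (proj L L') :=
  continuous_fst.prodMk (continuous_snd.fst.prodMk
    ((continuous_quotient_mk'.comp continuous_snd.snd.fst).prodMk
      (continuous_quotient_mk'.comp continuous_snd.snd.snd)))

variable [DiscreteTopology L] [DiscreteTopology L']

theorem isClosed_lattice {n : ℕ} (Λ : Submodule ℤ (EuclideanSpace ℝ (Fin n)))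
    [DiscreteTopology Λ] : IsClosed (Λ.toAddSubgroup : Set (EuclideanSpace ℝ (Fin n))) := by
  have : DiscreteTopology Λ.toAddSubgroup := ‹DiscreteTopology Λ›
  exact AddSubgroup.isClosed_of_discrete

theorem measurable_proj : Measurable (proj L L') := by
  have := isClosed_lattice L
  have := isClosed_lattice L'
  exact (continuous_proj L L').measurable

/-- Lusin–Souslin: an injective continuous image of a Borel set is Borel. Closedness of the lattices
makes the quotient spaces well behaved enough for it. -/
theorem measurableSet_proj_image {U : Set (Y l m)} (hU : MeasurableSet U)
    (hinj : InjOn (proj L L') U) : MeasurableSet (proj L L' '' U) := by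
  have := isClosed_lattice L
  have := isClosed_lattice L'
  exact hU.image_of_continuousOn_injOn (continuous_proj L L').continuousOn hinj

/-- The push-forward to the quotient of a translation invariant measure restricted to a
fundamental domain. -/
theorem exists_isQuotientVolume [IsZLattice ℝ L] [IsZLattice ℝ L'] (ν : Measure (Y l m))
    (hν : ∀ (a : EuclideanSpace ℝ (Fin l)) (a' : EuclideanSpace ℝ (Fin m)) (A : Set (Y l m)),
      MeasurableSet A → ν (translate a a' ⁻¹' A) = ν A) :
    ∃ (S : Set (EuclideanSpace ℝ (Fin l))) (S' : Set (EuclideanSpace ℝ (Fin m))),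
      MeasurableSet S ∧ MeasurableSet S' ∧ Bornology.IsBounded S ∧ Bornology.IsBounded S' ∧
      ∃ μ : Measure (X L L'), RiemVS.IsQuotientVolume (proj L L') ν μ ∧
        ∀ A : Set (X L L'), MeasurableSet A →
          μ A = ν (proj L L' ⁻¹' A ∩ (univ ×ˢ univ ×ˢ S ×ˢ S')) := by
  obtain ⟨S, hS, hSb, hSu⟩ := exists_fundamental_set L
  obtain ⟨S', hS', hSb', hSu'⟩ := exists_fundamental_set L'
  set T : Set (Y l m) := univ ×ˢ univ ×ˢ S ×ˢ S' with hT
  have hTm : MeasurableSet T := .prod .univ (.prod .univ (hS.prod hS'))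
  have hmap : ∀ A : Set (X L L'), MeasurableSet A →
      ((ν.restrict T).map (proj L L')) A = ν (proj L L' ⁻¹' A ∩ T) := fun A hA => by
    rw [Measure.map_apply (measurable_proj L L') hA,
      Measure.restrict_apply (measurable_proj L L' hA)]
  refine ⟨S, S', hS, hS', hSb, hSb', _, ?_, hmap⟩
  intro U hU hinj
  rw [hmap _ (measurableSet_proj_image L L' hU hinj)]
  -- Cut `U` according to the lattice vector that moves a point into `T`. The moved pieces
  -- reassemble to the part of the preimage of `proj '' U` inside `T`, and invariance of `ν` matches
  -- the measures piece by piece.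
  have hU_eq : U = ⋃ γ : L × L', U ∩ translate (γ.1 : EuclideanSpace ℝ (Fin l)) γ.2 ⁻¹' T := by
    rw [← inter_iUnion, eq_comm, inter_eq_left]
    intro y _
    obtain ⟨a, ha, -⟩ := hSu y.2.2.1
    obtain ⟨a', ha', -⟩ := hSu' y.2.2.2
    exact mem_iUnion.2 ⟨(a, a'), mem_univ _, mem_univ _, ha, ha'⟩
  have hV_eq : proj L L' ⁻¹' (proj L L' '' U) ∩ T =
      ⋃ γ : L × L', translate (-(γ.1 : EuclideanSpace ℝ (Fin l)))
        (-(γ.2 : EuclideanSpace ℝ (Fin m))) ⁻¹' (U ∩ translate (γ.1 : EuclideanSpace ℝ (Fin l)) γ.2 ⁻¹' T) := by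
    ext y
    simp only [mem_inter_iff, mem_preimage, mem_image, mem_iUnion, translate_translate_neg]
    constructor
    · rintro ⟨⟨z, hz, hzy⟩, hy⟩
      obtain ⟨a, a', rfl⟩ := (proj_eq_proj_iff L L' z y).1 hzy
      refine ⟨(a, a'), ?_, hy⟩
      have := translate_translate_neg (-(a : EuclideanSpace ℝ (Fin l)))
        (-(a' : EuclideanSpace ℝ (Fin m))) z
      rw [neg_neg, neg_neg] at this
      rwa [this]
    · rintro ⟨γ, h1, h2⟩
      refine ⟨⟨_, h1, ?_⟩, h2⟩
      rw [proj_eq_proj_iff]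
      exact ⟨γ.1, γ.2, (translate_translate_neg _ _ _).symm⟩
  have hmeas : ∀ γ : L × L', MeasurableSet
      (U ∩ translate (γ.1 : EuclideanSpace ℝ (Fin l)) γ.2 ⁻¹' T) := fun γ =>
    hU.inter (measurable_translate _ _ hTm)
  rw [hV_eq]
  conv_rhs => rw [hU_eq]
  rw [measure_iUnion _ fun γ => measurable_translate _ _ (hmeas γ), measure_iUnion _ hmeas]
  · exact tsum_congr fun γ => hν _ _ _ (hmeas γ)
  -- The pieces of `U` are disjoint because each orbit meets the fundamental domain once.
  · intro γ δ hne
    refine disjoint_left.2 fun y hy hy' => hne ?_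
    obtain ⟨-, -, h1, h2⟩ := hy.2
    obtain ⟨-, -, h3, h4⟩ := hy'.2
    exact Prod.ext ((hSu _).unique h1 h3) ((hSu' _).unique h2 h4)
  -- The moved pieces are disjoint because the projection is injective on `U`.
  · intro γ δ hne
    refine disjoint_left.2 fun y hy hy' => hne ?_
    have e := hinj hy.1 hy'.1 (((proj_eq_proj_iff L L' _ y).2
      ⟨γ.1, γ.2, (translate_translate_neg _ _ _).symm⟩).trans ((proj_eq_proj_iff L L' _ y).2
      ⟨δ.1, δ.2, (translate_translate_neg _ _ _).symm⟩).symm)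
    simp only [translate, add_right_inj, Prod.mk.injEq, neg_inj, SetLike.coe_eq_coe, true_and] at e
    exact Prod.ext e.1 e.2

end Quotient

instance : (volume : Measure (Z l m)).IsAddHaarMeasure := by
  have : (volume : Measure
      (EuclideanSpace ℝ (Fin l) × EuclideanSpace ℝ (Fin m))).IsAddHaarMeasure :=
    Measure.prod.instIsAddHaarMeasure _ _
  exact Measure.prod.instIsAddHaarMeasure _ _

instance : (volume : Measure (Y l m)).IsAddHaarMeasure := Measure.prod.instIsAddHaarMeasure _ _

/-- Integral of a product function over a product set. -/
theorem setLIntegral_prod_mul {α β : Type*} [MeasureSpace α] [MeasureSpace β]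
    [SFinite (volume : Measure α)] [SFinite (volume : Measure β)] (s : Set α) (t : Set β)
    {f : α → ENNReal} {g : β → ENNReal} (hf : Measurable f) (hg : Measurable g) :
    ∫⁻ z in s ×ˢ t, f z.1 * g z.2 = (∫⁻ x in s, f x) * ∫⁻ y in t, g y := by
  rw [Measure.volume_eq_prod, ← Measure.prod_restrict,
    lintegral_prod_mul hf.aemeasurable hg.aemeasurable]

theorem setLIntegral_exp_lt_top (c : ℝ) :
    ∫⁻ x in Iic c, ENNReal.ofReal (Real.exp (1 / 2 * x)) < ⊤ :=
  (integrableOn_exp_mul_Iic (by norm_num : (0 : ℝ) < 1 / 2) c).lintegral_lt_top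

/-- The function `e^{(r + t) / 2}` has finite integral over the relevant part of a fundamental
domain. -/
theorem setLIntegral_exp_cusp_lt_top {S : Set (EuclideanSpace ℝ (Fin l))}
    {S' : Set (EuclideanSpace ℝ (Fin m))} (hS : Bornology.IsBounded S)
    (hS' : Bornology.IsBounded S') :
    ∫⁻ y in (Iic (-1 : ℝ)) ×ˢ (Iic (2 : ℝ)) ×ˢ S ×ˢ S',
      ENNReal.ofReal (Real.exp (1 / 2 * y.1)) * ENNReal.ofReal (Real.exp (1 / 2 * y.2.1)) < ⊤ := by
  have hm : Measurable fun x : ℝ => ENNReal.ofReal (Real.exp (1 / 2 * x)) := by fun_prop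
  have h1 := setLIntegral_prod_mul (Iic (-1 : ℝ)) ((Iic (2 : ℝ)) ×ˢ S ×ˢ S') hm
    (g := fun z : Z l m => ENNReal.ofReal (Real.exp (1 / 2 * z.1)) * 1) (by fun_prop)
  have h2 := setLIntegral_prod_mul (Iic (2 : ℝ)) (S ×ˢ S') hm
    (g := fun _ : EuclideanSpace ℝ (Fin l) × EuclideanSpace ℝ (Fin m) => 1) (by fun_prop)
  rw [h2] at h1
  simp only [mul_one] at h1
  rw [h1]
  refine ENNReal.mul_lt_top (setLIntegral_exp_lt_top _)
    (ENNReal.mul_lt_top (setLIntegral_exp_lt_top _) ?_)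
  rw [setLIntegral_one]
  exact (hS.prod hS').measure_lt_top

end WarpedModel

/-! ### Isometries of the flat factors and the volume density -/

namespace WarpedModel

open RiemVS

variable {l m : ℕ}

section Isometries

variable {g : Metric (Y l m)} {A P Q : ℝ → ℝ → ℝ}

/-- Mazur–Ulam: a surjective isometry of a real normed space is affine. -/
theorem isometryEquiv_eq {n : ℕ} (φ : EuclideanSpace ℝ (Fin n) ≃ᵢ EuclideanSpace ℝ (Fin n)) :
    ∃ T : EuclideanSpace ℝ (Fin n) ≃ₗᵢ[ℝ] EuclideanSpace ℝ (Fin n), ∀ x, φ x = T x + φ 0 := by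
  refine ⟨φ.toRealAffineIsometryEquiv.linearIsometryEquiv, fun x => ?_⟩
  have := φ.toRealAffineIsometryEquiv.map_vadd 0 x
  simpa using this

/-- A pair of isometries of the flat factors acts by isometries. -/
theorem preserves_of_form
    (hg : ∀ y v w : Y l m, form g y v w =
      formY (A y.1 y.2.1) (P y.1 y.2.1) (Q y.1 y.2.1) v w)
    (φ : EuclideanSpace ℝ (Fin l) ≃ᵢ EuclideanSpace ℝ (Fin l))
    (ψ : EuclideanSpace ℝ (Fin m) ≃ᵢ EuclideanSpace ℝ (Fin m)) :
    Preserves g fun y => (y.1, y.2.1, φ y.2.2.1, ψ y.2.2.2) := by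
  obtain ⟨T, hT⟩ := isometryEquiv_eq φ
  obtain ⟨T', hT'⟩ := isometryEquiv_eq ψ
  have hφ : ∀ x, HasFDerivAt φ (T : EuclideanSpace ℝ (Fin l) →L[ℝ] _) x := fun x => by
    rw [funext hT]
    exact (T : EuclideanSpace ℝ (Fin l) →L[ℝ] EuclideanSpace ℝ (Fin l)).hasFDerivAt.add_const _
  have hψ : ∀ x, HasFDerivAt ψ (T' : EuclideanSpace ℝ (Fin m) →L[ℝ] _) x := fun x => by
    rw [funext hT']
    exact (T' : EuclideanSpace ℝ (Fin m) →L[ℝ] EuclideanSpace ℝ (Fin m)).hasFDerivAt.add_const _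
  constructor
  · have cφ : ContDiff ℝ ∞ φ := by
      rw [funext hT]
      exact T.contDiff.add contDiff_const
    have cψ : ContDiff ℝ ∞ ψ := by
      rw [funext hT']
      exact T'.contDiff.add contDiff_const
    exact contDiff_fst.prodMk (contDiff_snd.fst.prodMk
      ((cφ.comp contDiff_snd.snd.fst).prodMk (cψ.comp contDiff_snd.snd.snd)))
  · intro y u v
    have h1 : HasFDerivAt (fun y : Y l m => y.2.2)
        (.snd ℝ ℝ _ ∘L .snd ℝ ℝ (Z l m)) y := (hasFDerivAt_snd (p := y.2)).comp y hasFDerivAt_snd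
    have key := hasFDerivAt_fst.prodMk (((hasFDerivAt_fst (p := y.2)).comp y
      hasFDerivAt_snd).prodMk (((hφ _).comp y ((hasFDerivAt_fst (p := y.2.2)).comp y h1)).prodMk
        ((hψ _).comp y ((hasFDerivAt_snd (p := y.2.2)).comp y h1))))
    have hd : ∀ v : Y l m, fderiv ℝ
        (fun y : Y l m => ((y.1, y.2.1, φ y.2.2.1, ψ y.2.2.2) : Y l m)) y v =
          (v.1, v.2.1, T v.2.2.1, T' v.2.2.2) := fun v =>
      congrArg (fun S : Y l m →L[ℝ] Y l m => S v) key.fderiv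
    rw [hd, hd, hg, hg]
    simp [formY, formZ]

end Isometries

theorem det_formY (A P Q : ℝ) :
    Matrix.det (Matrix.of fun i j => formY A P Q (stdBasis l m i) (stdBasis l m j)) =
      A * (A * P) ^ l * (A * Q) ^ m := by
  have : (Matrix.of fun i j => formY A P Q (stdBasis l m i) (stdBasis l m j)) =
      Matrix.diagonal (Sum.elim (fun _ => 1) (Sum.elim (fun _ => A)
        (Sum.elim (fun _ => A * P) fun _ => A * Q))) := by
    ext i j
    rcases i with i | i | i | i <;> rcases j with j | j | j | j <;>
      simp [stdBasis, formY, formZ, Matrix.diagonal_apply, EuclideanSpace.inner_single_left,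
        eq_comm]
  rw [this, Matrix.det_diagonal]
  simp [mul_assoc]

end WarpedModel

/-! ### Finite volume of the end -/

namespace WarpedModel

open RiemVS

variable {l m : ℕ}

section Volume

variable {g : Metric (Y l m)} {A P Q : ℝ → ℝ → ℝ}

theorem volumeOf_eq_withDensity
    (hg : ∀ y v w : Y l m, form g y v w =
      formY (A y.1 y.2.1) (P y.1 y.2.1) (Q y.1 y.2.1) v w) :
    volumeOf (stdBasis l m) g = (stdBasis l m).addHaar.withDensity fun y =>
      ENNReal.ofReal (Real.sqrt (A y.1 y.2.1 * (A y.1 y.2.1 * P y.1 y.2.1) ^ l *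
        (A y.1 y.2.1 * Q y.1 y.2.1) ^ m)) := by
  simp only [volumeOf, hg, det_formY]

theorem volumeOf_preimage_translate
    (hg : ∀ y v w : Y l m, form g y v w =
      formY (A y.1 y.2.1) (P y.1 y.2.1) (Q y.1 y.2.1) v w)
    (a : EuclideanSpace ℝ (Fin l)) (a' : EuclideanSpace ℝ (Fin m)) {U : Set (Y l m)}
    (hU : MeasurableSet U) :
    volumeOf (stdBasis l m) g (translate a a' ⁻¹' U) = volumeOf (stdBasis l m) g U := by
  rw [volumeOf_eq_withDensity hg, withDensity_apply _ (measurable_translate a a' hU),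
    withDensity_apply _ hU]
  refine Eq.trans ?_ ((measurePreserving_add_right (stdBasis l m).addHaar
      ((0, 0, a, a') : Y l m)).setLIntegral_comp_preimage_emb
      (MeasurableEquiv.addRight ((0, 0, a, a') : Y l m)).measurableEmbedding _ U)
  refine setLIntegral_congr_fun (measurable_translate a a' hU) fun y _ => ?_
  simp

end Volume

namespace Profile

variable (D : Profile)

theorem h_le_two {r : ℝ} (hr : r ≤ -1) : D.h r ≤ 2 := by
  rw [D.h_left r hr]
  have : Real.exp r ≤ 1 := Real.exp_le_one_iff.2 (by linarith)
  linarith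

theorem warp_le {b : ℝ} (hb : 0 < b) {r : ℝ} (hr : r ≤ -1) :
    D.warp b r ≤ 2 * b * Real.exp r := by
  have h1 := mul_le_mul_of_nonneg_left (D.h_le_two hr) (by positivity : 0 ≤ b * Real.exp r)
  rw [warp, D.R_left r (by linarith)]
  linarith

/-- The growth of `f(t - r)` as `r → -∞` is compensated by `e^r`, since `e^r f(t - r) ≤ e^r + c
e^t`. -/
theorem fib_le {b : ℝ} (hb : 0 < b) {r t : ℝ} (hr : r ≤ -1) (ht : t ≤ 2) :
    D.fib b r t ≤ 2 * b * (1 + D.c * Real.exp 2) := by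
  have h0 := D.h_pos r
  have hf := D.f_le (t - r)
  have hf1 := D.f_ge_one (t - r)
  have hc := D.c_nonneg
  have he : Real.exp r ≤ 1 := Real.exp_le_one_iff.2 (by linarith)
  have h1 : Real.exp r * D.f (t - r) ≤ 1 + D.c * Real.exp 2 := by
    calc Real.exp r * D.f (t - r) ≤ Real.exp r * (1 + D.c * Real.exp (t - r)) := by gcongr
      _ = Real.exp r + D.c * Real.exp t := by
        rw [Real.exp_sub]; field_simp
      _ ≤ 1 + D.c * Real.exp 2 := by gcongr
  rw [fib, D.R_left r (by linarith)]
  calc b * Real.exp r * (D.h r * D.f (t - r)) = b * D.h r * (Real.exp r * D.f (t - r)) := by ring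
    _ ≤ b * 2 * (1 + D.c * Real.exp 2) := by
      gcongr
      exact D.h_le_two hr
    _ = _ := by ring

theorem sqrt_det_le {b : ℝ} (hb : 0 < b) (hl : 0 < l) {r t : ℝ} (hr : r ≤ -1)
    (hrt : r - 1 ≤ t) (ht : t ≤ 2) :
    Real.sqrt (D.h r ^ 2 * (D.warp b r ^ 2) ^ l * (D.fib b r t ^ 2) ^ m) ≤
      2 * (2 * b) ^ l * (2 * b * (1 + D.c * Real.exp 2)) ^ m * Real.exp (1 / 2) *
        (Real.exp (1 / 2 * r) * Real.exp (1 / 2 * t)) := by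
  have h0 := D.h_pos r
  have hw := D.warp_pos hb r
  have hq := D.fib_pos hb r t
  have hc := D.c_nonneg
  have e1 : D.h r ^ 2 * (D.warp b r ^ 2) ^ l * (D.fib b r t ^ 2) ^ m =
      (D.h r * D.warp b r ^ l * D.fib b r t ^ m) ^ 2 := by ring
  rw [e1, Real.sqrt_sq (by positivity)]
  -- One factor `e^r` suffices, and `r ≤ 1/2 + r/2 + t/2` is the condition `t ≥ r - 1`. The decay is
  -- shared between both variables so that the wedge can be enlarged to a product of half-lines.
  have e2 : Real.exp r ^ l ≤ Real.exp (1 / 2) * (Real.exp (1 / 2 * r) * Real.exp (1 / 2 * t)) := by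
    calc Real.exp r ^ l ≤ Real.exp r :=
        pow_le_of_le_one (Real.exp_nonneg _) (Real.exp_le_one_iff.2 (by linarith)) hl.ne'
      _ ≤ _ := by
        rw [← Real.exp_add, ← Real.exp_add]
        exact Real.exp_le_exp.2 (by linarith)
  calc D.h r * D.warp b r ^ l * D.fib b r t ^ m
      ≤ 2 * (2 * b * Real.exp r) ^ l * (2 * b * (1 + D.c * Real.exp 2)) ^ m := by
        gcongr
        · exact D.h_le_two hr
        · exact D.warp_le hb hr
        · exact D.fib_le hb hr ht
    _ = 2 * (2 * b) ^ l * (2 * b * (1 + D.c * Real.exp 2)) ^ m * Real.exp r ^ l := by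
        rw [mul_pow _ (Real.exp r)]; ring
    _ ≤ 2 * (2 * b) ^ l * (2 * b * (1 + D.c * Real.exp 2)) ^ m *
        (Real.exp (1 / 2) * (Real.exp (1 / 2 * r) * Real.exp (1 / 2 * t))) := by gcongr
    _ = _ := by ring

/-- The end `r ≤ -1`, `r - 1 ≤ t ≤ 2` of the quotient by lattices has finite volume. -/
theorem exists_isQuotientVolume_lt_top {g : Metric (Y l m)} {b : ℝ} (hb : 0 < b) (hl : 0 < l)
    (hg : ∀ y v w : Y l m, form g y v w =
      formY (D.h y.1 ^ 2) (b ^ 2 * Real.exp (2 * D.R y.1)) (D.F b y.1 y.2.1 ^ 2) v w)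
    (L : Submodule ℤ (EuclideanSpace ℝ (Fin l))) (L' : Submodule ℤ (EuclideanSpace ℝ (Fin m)))
    [DiscreteTopology L] [IsZLattice ℝ L] [DiscreteTopology L'] [IsZLattice ℝ L'] :
    ∃ μ : Measure (X L L'),
      IsQuotientVolume (proj L L') (volumeOf (stdBasis l m) g) μ ∧
        μ {x | x.1 ≤ -1 ∧ x.1 - 1 ≤ x.2.1 ∧ x.2.1 ≤ 2} < ⊤ := by
  obtain ⟨S, S', hS, hS', bS, bS', μ, hμ, hμA⟩ :=
    exists_isQuotientVolume L L' (volumeOf (stdBasis l m) g)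
      fun a a' U hU => volumeOf_preimage_translate (A := fun r _ => D.h r ^ 2)
        (P := fun r _ => b ^ 2 * Real.exp (2 * D.R r)) (Q := fun r t => D.F b r t ^ 2) hg a a' hU
  refine ⟨μ, hμ, ?_⟩
  have hT : MeasurableSet {x : ℝ × ℝ | x.1 ≤ -1 ∧ x.1 - 1 ≤ x.2 ∧ x.2 ≤ 2} :=
    (measurableSet_le measurable_fst measurable_const).inter
      ((measurableSet_le (measurable_fst.sub_const 1) measurable_snd).inter
        (measurableSet_le measurable_snd measurable_const))
  have hA : MeasurableSet {x : X L L' | x.1 ≤ -1 ∧ x.1 - 1 ≤ x.2.1 ∧ x.2.1 ≤ 2} :=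
    (measurable_fst.prodMk measurable_snd.fst : Measurable fun x : X L L' => (x.1, x.2.1)) hT
  have hV : MeasurableSet {y : Y l m | y.1 ≤ -1 ∧ y.1 - 1 ≤ y.2.1 ∧ y.2.1 ≤ 2} :=
    (measurable_fst.prodMk measurable_snd.fst : Measurable fun x : Y l m => (x.1, x.2.1)) hT
  have hB : MeasurableSet (univ ×ˢ univ ×ˢ S ×ˢ S' : Set (Y l m)) :=
    MeasurableSet.univ.prod (MeasurableSet.univ.prod (hS.prod hS'))
  have hVB := hV.inter hB
  rw [hμA _ hA]
  change volumeOf (stdBasis l m) g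
    ({y : Y l m | y.1 ≤ -1 ∧ y.1 - 1 ≤ y.2.1 ∧ y.2.1 ≤ 2} ∩ _) < ⊤
  set K := 2 * (2 * b) ^ l * (2 * b * (1 + D.c * Real.exp 2)) ^ m * Real.exp (1 / 2) with hK
  have hK0 : 0 ≤ K := by
    have := D.c_nonneg
    positivity
  rw [volumeOf_eq_withDensity (A := fun r _ => D.h r ^ 2)
    (P := fun r _ => b ^ 2 * Real.exp (2 * D.R r)) (Q := fun r t => D.F b r t ^ 2) hg,
    withDensity_apply _ hVB]
  calc _ ≤ ∫⁻ y in {y : Y l m | y.1 ≤ -1 ∧ y.1 - 1 ≤ y.2.1 ∧ y.2.1 ≤ 2} ∩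
          univ ×ˢ univ ×ˢ S ×ˢ S', ENNReal.ofReal K * (ENNReal.ofReal (Real.exp (1 / 2 * y.1)) *
            ENNReal.ofReal (Real.exp (1 / 2 * y.2.1))) ∂(stdBasis l m).addHaar := by
        refine setLIntegral_mono' hVB fun y hy => ?_
        obtain ⟨⟨h1, h2, h3⟩, -⟩ := hy
        rw [← ENNReal.ofReal_mul (Real.exp_nonneg _), ← ENNReal.ofReal_mul hK0]
        refine ENNReal.ofReal_le_ofReal (le_trans (le_of_eq ?_) (D.sqrt_det_le hb hl h1 h2 h3))
        have e1 : D.h y.1 ^ 2 * (b ^ 2 * Real.exp (2 * D.R y.1)) = D.warp b y.1 ^ 2 := by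
          rw [warp, two_mul, Real.exp_add]; ring
        have e2 : D.h y.1 ^ 2 * D.F b y.1 y.2.1 ^ 2 = D.fib b y.1 y.2.1 ^ 2 := by
          rw [fib, F]; ring
        simp only [e1, e2]
    _ ≤ ∫⁻ y in Iic (-1) ×ˢ Iic 2 ×ˢ S ×ˢ S', ENNReal.ofReal K *
          (ENNReal.ofReal (Real.exp (1 / 2 * y.1)) *
            ENNReal.ofReal (Real.exp (1 / 2 * y.2.1))) ∂(stdBasis l m).addHaar :=
        lintegral_mono_set fun y ⟨⟨h1, _, h3⟩, _, _, h4⟩ => ⟨h1, h3, h4⟩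
    _ = ENNReal.ofReal K * ∫⁻ y in Iic (-1) ×ˢ Iic 2 ×ˢ S ×ˢ S',
          (ENNReal.ofReal (Real.exp (1 / 2 * y.1)) *
            ENNReal.ofReal (Real.exp (1 / 2 * y.2.1))) ∂(stdBasis l m).addHaar :=
        lintegral_const_mul' _ _ ENNReal.ofReal_ne_top
    _ < ⊤ := by
        refine ENNReal.mul_lt_top ENNReal.ofReal_lt_top ?_
        -- Haar measures are proportional, so the integral may be taken for product Lebesgue
        -- measure, where Tonelli applies.
        rw [Measure.isAddLeftInvariant_eq_smul (stdBasis l m).addHaar (volume : Measure (Y l m)),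
          Measure.restrict_smul, lintegral_smul_measure]
        exact ENNReal.mul_lt_top ENNReal.coe_lt_top (setLIntegral_exp_cusp_lt_top bS bS')

end Profile

end WarpedModel

/-! ### The metrics `g` and `ĝ`, and the final assembly -/

namespace WarpedModel.Profile

open RiemVS

variable (D : Profile) {b : ℝ} {l m : ℕ}

/-- The metric `dr² + h² (dt² + b² e^{2R} dρ² + F² dτ²)`. -/
def metric (hb : 0 < b) (l m : ℕ) : Metric (Y l m) :=
  ofForm (D.metricForm b) fourBlock_symm (fourBlock_pos D.h_pos (D.warp_pos hb) (D.fib_pos hb))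
    (D.contDiff_metricForm b)

theorem form_metric (hb : 0 < b) : form (D.metric hb l m) = D.metricForm b := rfl

theorem form_metric_apply (hb : 0 < b) (y v w : Y l m) :
    form (D.metric hb l m) y v w =
      formY (D.h y.1 ^ 2) (b ^ 2 * Real.exp (2 * D.R y.1)) (D.F b y.1 y.2.1 ^ 2) v w := by
  rw [form_metric, metricForm, fourBlock_apply, warp, fib, formY, formZ, F, two_mul, Real.exp_add]
  ring

/-- The metric `dt² + b² e^6 dρ² + b² e^6 f(t - 3)² dτ²`. -/
def metricHat (hb : 0 < b) (l m : ℕ) : Metric (Z l m) :=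
  ofForm (threeBlock (b * Real.exp 3) fun t => b * Real.exp 3 * D.f (t - 3)) threeBlock_symm
    (threeBlock_pos (by positivity) fun t =>
      mul_pos (by positivity) (one_pos.trans_le (D.f_ge_one _)))
    (contDiff_threeBlock (contDiff_const.mul (D.f_smooth.comp (contDiff_id.sub contDiff_const))))

theorem form_metricHat_apply (hb : 0 < b) (z v w : Z l m) :
    form (D.metricHat hb l m) z v w =
      formZ (b ^ 2 * Real.exp 6) (b ^ 2 * Real.exp 6 * D.f (z.1 - 3) ^ 2) v w := by
  have e : Real.exp 6 = Real.exp 3 ^ 2 := by rw [← Real.exp_nat_mul]; norm_num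
  rw [metricHat, form_ofForm, threeBlock_apply, formZ, e]
  ring

/-- The warping function is positive and convex, since `f'' = f' + λ ≥ 0`; the other curvature term
is minus a square times a Gram determinant. -/
theorem sectional_metricHat_nonpos (hb : 0 < b) {z u v : Z l m}
    (h : LinearIndependent ℝ ![u, v]) : sectional (D.metricHat hb l m) z u v ≤ 0 := by
  have hk : 0 < b * Real.exp 3 := by positivity
  have hq0 : ∀ t, 0 < b * Real.exp 3 * D.f (t - 3) := fun t =>
    mul_pos hk (one_pos.trans_le (D.f_ge_one _))
  have hq : ∀ t, HasDerivAt (fun t => b * Real.exp 3 * D.f (t - 3))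
      (b * Real.exp 3 * D.f1 (t - 3)) t := fun t =>
    ((D.hasDerivAt_f _).comp_sub_const t 3).const_mul _
  have hq1 : ∀ t, HasDerivAt (fun t => b * Real.exp 3 * D.f1 (t - 3))
      (b * Real.exp 3 * (D.f1 (t - 3) + D.lam (t - 3))) t := fun t =>
    ((D.hasDerivAt_f1 _).comp_sub_const t 3).const_mul _
  refine div_nonpos_of_nonpos_of_nonneg ?_
    (area_pos _ (threeBlock_pos hk hq0 z) (threeBlock_symm z) h).le
  refine (form_curvature_threeBlock hk hq0 (contDiff_threeBlock (contDiff_const.mul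
    (D.f_smooth.comp (contDiff_id.sub contDiff_const)))) hq hq1 z u v).trans_le ?_
  have h2 : 0 ≤ D.f1 (z.1 - 3) + D.lam (z.1 - 3) :=
    add_nonneg (D.f1_nonneg _) (D.lam_nonneg _)
  have cs : inner ℝ u.2.2 v.2.2 ^ 2 ≤ ‖u.2.2‖ ^ 2 * ‖v.2.2‖ ^ 2 := by
    rw [← mul_pow]
    exact sq_le_sq' (neg_le_of_abs_le (abs_real_inner_le_norm _ _)) (real_inner_le_norm _ _)
  have h0 := hq0 z.1
  have h1 := mul_nonneg (sq_nonneg (b * Real.exp 3 * D.f (z.1 - 3)))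
    (sq_nonneg (b * Real.exp 3 * D.f1 (z.1 - 3)))
  have h3 := mul_nonneg h1 (sub_nonneg.2 cs)
  have h4 := mul_nonneg (mul_nonneg h0.le (mul_nonneg hk.le h2))
    (sq_nonneg ‖u.1 • v.2.2 - v.1 • u.2.2‖)
  linarith

theorem exists_sectional_metric_bounds (hb : 0 < b) (l m : ℕ) :
    ∃ C : ℝ, C < 0 ∧ ∀ y u v : Y l m, LinearIndependent ℝ ![u, v] →
      C ≤ sectional (D.metric hb l m) y u v ∧ sectional (D.metric hb l m) y u v < 0 := by
  obtain ⟨K, hK, hKh⟩ := D.exists_deriv_h_le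
  obtain ⟨M, hM, hlam⟩ := D.exists_lam_le
  refine ⟨-((K + 1) ^ 2 + 1 + M + M), by nlinarith [sq_nonneg (K + 1)], fun y u v h => ?_⟩
  have harea := area_pos (D.metricForm b y)
    (fourBlock_pos D.h_pos (D.warp_pos hb) (D.fib_pos hb) y) (fourBlock_symm y) h
  obtain ⟨k, hk, bounds⟩ := D.exists_bounds_metricForm hb hK hKh hlam y
  obtain ⟨h1, h2⟩ := bounds u v
  rw [sectional, form_metric]
  exact ⟨(le_div_iff₀ harea).2 (by linarith),
    div_neg_of_neg_of_pos (h2.trans_lt (neg_neg_of_pos (mul_pos hk harea))) harea⟩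

end WarpedModel.Profile

end

theorem mainTheorem8 :
    Nonempty WarpedModel.Profile ∧
    ∀ (D : WarpedModel.Profile) (b : ℝ), 0 < b → ∀ l m : ℕ, 0 < l → 0 < m →
      ∃ (g : RiemVS.Metric (WarpedModel.Y l m)) (ghat : RiemVS.Metric (WarpedModel.Z l m)),
        -- the explicit form of `g` and of `ghat`
        (∀ (y v w : WarpedModel.Y l m), RiemVS.form g y v w =
          WarpedModel.formY (D.h y.1 ^ 2) (b ^ 2 * Real.exp (2 * D.R y.1))
            (D.F b y.1 y.2.1 ^ 2) v w) ∧
        (∀ (z v w : WarpedModel.Z l m), RiemVS.form ghat z v w =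
          WarpedModel.formZ (b ^ 2 * Real.exp 6)
            (b ^ 2 * Real.exp 6 * D.f (z.1 - 3) ^ 2) v w) ∧
        -- invariance under the isometries of `ℝ^l` and of `ℝ^m`
        (∀ φ : EuclideanSpace ℝ (Fin l) ≃ᵢ EuclideanSpace ℝ (Fin l),
          RiemVS.Preserves g fun y => (y.1, y.2.1, φ y.2.2.1, y.2.2.2)) ∧
        (∀ ψ : EuclideanSpace ℝ (Fin m) ≃ᵢ EuclideanSpace ℝ (Fin m),
          RiemVS.Preserves g fun y => (y.1, y.2.1, y.2.2.1, ψ y.2.2.2)) ∧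
        -- (1)
        (∃ C : ℝ, C < 0 ∧ ∀ y u v : WarpedModel.Y l m, LinearIndependent ℝ ![u, v] →
          C ≤ RiemVS.sectional g y u v ∧ RiemVS.sectional g y u v < 0) ∧
        -- (2): `g` descends to a metric `gX` on the quotient, with Riemannian volume `μ`
        (∀ (L : Submodule ℤ (EuclideanSpace ℝ (Fin l)))
            (L' : Submodule ℤ (EuclideanSpace ℝ (Fin m)))
            [DiscreteTopology L] [IsZLattice ℝ L] [DiscreteTopology L'] [IsZLattice ℝ L'],
          (∃ gX : WarpedModel.X L L' →
              WarpedModel.Y l m →L[ℝ] WarpedModel.Y l m →L[ℝ] ℝ,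
            ∀ y, gX (WarpedModel.proj L L' y) = RiemVS.form g y) ∧
          ∃ μ : MeasureTheory.Measure (WarpedModel.X L L'),
            RiemVS.IsQuotientVolume (WarpedModel.proj L L')
              (RiemVS.volumeOf (WarpedModel.stdBasis l m) g) μ ∧
            μ {x | x.1 ≤ -1 ∧ x.1 - 1 ≤ x.2.1 ∧ x.2.1 ≤ 2} < ⊤) ∧
        -- (3)
        (∀ y : WarpedModel.Y l m, y.1 ≤ 0 → y.2.1 ≤ y.1 - 1 → ∀ v w, RiemVS.form g y v w =
          WarpedModel.formY (D.h y.1 ^ 2) (b ^ 2 * Real.exp (2 * y.1))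
            (b ^ 2 * Real.exp (2 * y.1)) v w) ∧
        -- (4)
        (∀ y : WarpedModel.Y l m, 0 ≤ y.1 → y.2.1 ≤ -1 → ∀ v w, RiemVS.form g y v w =
          WarpedModel.formY (D.h y.1 ^ 2) (b ^ 2 * Real.exp (2 * D.R y.1))
            (b ^ 2 * Real.exp (2 * D.R y.1)) v w) ∧
        -- (5)
        (∀ y : WarpedModel.Y l m, 4 ≤ y.2.1 → ∀ v w, RiemVS.form g y v w =
          WarpedModel.formY (D.h y.1 ^ 2) (b ^ 2 * Real.exp (2 * D.R y.1))
            (b ^ 2 * D.c ^ 2 * Real.exp (2 * y.2.1)) v w) ∧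
        -- (6)
        (∀ y : WarpedModel.Y l m, 5 ≤ y.1 → ∀ v w, RiemVS.form g y v w =
          v.1 * w.1 + 4 * Real.exp (2 * y.1) * RiemVS.form ghat y.2 v.2 w.2) ∧
        -- (7)
        (∀ z u v : WarpedModel.Z l m, LinearIndependent ℝ ![u, v] →
          RiemVS.sectional ghat z u v ≤ 0) := by
  refine ⟨WarpedModel.nonempty_profile, fun D b hb l m hl _ => ?_⟩
  have hg := D.form_metric_apply (l := l) (m := m) hb
  have hexp : ∀ x : ℝ, Real.exp (2 * x) = Real.exp x ^ 2 := fun x => by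
    rw [two_mul, Real.exp_add, sq]
  refine ⟨D.metric hb l m, D.metricHat hb l m, hg, D.form_metricHat_apply hb, fun φ => ?_,
    fun ψ => ?_, D.exists_sectional_metric_bounds hb l m, fun L L' _ _ _ _ => ⟨⟨fun x =>
    RiemVS.form (D.metric hb l m) (x.1, x.2.1, 0, 0), fun y => ?_⟩,
    D.exists_isQuotientVolume_lt_top hb hl hg L L'⟩, fun y h1 h2 v w => ?_, fun y h1 h2 v w => ?_,
    fun y h1 v w => ?_, fun y h1 v w => ?_, fun z u v h => D.sectional_metricHat_nonpos hb h⟩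
  · exact WarpedModel.preserves_of_form (A := fun r _ => D.h r ^ 2)
      (P := fun r _ => b ^ 2 * Real.exp (2 * D.R r)) (Q := fun r t => D.F b r t ^ 2) hg φ
      (IsometryEquiv.refl _)
  · exact WarpedModel.preserves_of_form (A := fun r _ => D.h r ^ 2)
      (P := fun r _ => b ^ 2 * Real.exp (2 * D.R r)) (Q := fun r t => D.F b r t ^ 2) hg
      (IsometryEquiv.refl _) ψ
  -- The coefficients do not depend on `ρ` and `τ`, so evaluating at `ρ = 0`, `τ = 0` defines the
  -- descended form.
  · refine ContinuousLinearMap.ext fun v => ContinuousLinearMap.ext fun w => ?_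
    rw [hg, hg]
    rfl
  -- In this case and the next, `t - R(r) ≤ -1`, where `f = 1`.
  · have hR : D.R y.1 = y.1 := D.R_left _ (by linarith)
    rw [hg, WarpedModel.Profile.F, hR, D.f_of_le (by linarith), mul_one, mul_pow, hexp]
  · have hR := D.R_nonneg h1
    rw [hg, WarpedModel.Profile.F, D.f_of_le (by linarith), mul_one, mul_pow, hexp]
  -- `R ≤ 3` and `t ≥ 4` give `t - R(r) ≥ 1`, where `f(s) = c e^s`; the factors `e^R` and `e^{-R}`
  -- cancel.
  · have hR := D.R_le_three y.1
    have e : D.F b y.1 y.2.1 ^ 2 = b ^ 2 * D.c ^ 2 * Real.exp (2 * y.2.1) := by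
      rw [WarpedModel.Profile.F, D.f_of_ge (by linarith), Real.exp_sub, hexp]
      field_simp
    rw [hg, e]
  · have e : Real.exp 6 = Real.exp 3 ^ 2 := by rw [← hexp]; norm_num
    rw [hg, D.form_metricHat_apply, WarpedModel.Profile.F, D.h_right _ (by linarith),
      D.R_right _ h1, WarpedModel.formY, hexp, hexp, e]
    ring_nf
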